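/- Throughout, Banach algebras are complex, associative, not necessarily unital, with submultiplicative norm. Let $A$ be a Banach algebra. A Banach $A$-bimodule is a complex Banach space $E$ with commuting left and right actions of $A$ given by bounded bilinear maps; its dual $E^*$ is a Banach $A$-bimodule via $\langle a\cdot f,x\rangle=\langle f,x\cdot a\rangle$ and $\langle f\cdot a,x\rangle=\langle f,a\cdot x\rangle$. A continuous linear map $D:A\to E$ is a derivation if $D(ab)=D(a)\cdot b+a\cdot D(b)$ for all $a,b\in A$, and it is inner if there is $z\in E$ with $D(a)=a\cdot z-z\cdot a$ for all $a\in A$. The algebra $A$ is amenable if, for every Banach $A$-bimodule $E$, every continuous derivation $A\to E^*$ is inner; it is weakly amenable if every continuous derivation $A\to A^*$ is inner. Let $\Delta(A)$ be the set of characters (non-zero multiplicative linear functionals) of $A$. The algebra $A$ is $0$-point amenable if, for every $\varphi\in\Delta(A)\cup\{0\}$, the only continuous linear functional $D:A\to\mathbb C$ with $D(ab)=D(a)\varphi(b)+\varphi(a)D(b)$ for all $a,b\in A$ is $D=0$. Theorem 5.1. Let $X$ be a non-empty locally compact Hausdorff space, let $A$ be a Banach algebra, and let $C_0(X,A)$ be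 the Banach algebra of continuous functions $X\to A$ vanishing at infinity, with pointwise operations and the supremum norm. Then: (i) $C_0(X,A)$ is amenable if and only if $A$ is amenable. (ii) $C_0(X,A)$ is $0$-point amenable if and only if $A$ is $0$-point amenable. (iii) If $A$ is commutative, then $C_0(X,A)$ is weakly amenable if and only if $A$ is weakly amenable. -/

import Mathlib

open scoped ZeroAtInfty

universe u v w

/-- A Banach `A`-bimodule structure on the complex Banach space `E`, where `A` is a complex Banach
algebra that need not have a unit: `left a x` is `a · x` and `right a x` is `x · a`. -/
structure BanachBimodule (A : Type u) [NonUnitalNormedRing A] [NormedSpace ℂ A]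
    (E : Type w) [NormedAddCommGroup E] [NormedSpace ℂ E] where
  left : A →L[ℂ] E →L[ℂ] E
  right : A →L[ℂ] E →L[ℂ] E
  left_mul : ∀ (a b : A) (x : E), left (a * b) x = left a (left b x)
  right_mul : ∀ (a b : A) (x : E), right (a * b) x = right b (right a x)
  left_right : ∀ (a b : A) (x : E), left a (right b x) = right b (left a x)

namespace BanachBimodule

/-- `A` as a Banach bimodule over itself, by multiplication on both sides. -/
noncomputable def regular (A : Type u) [NonUnitalNormedRing A] [NormedSpace ℂ A]
    [IsScalarTower ℂ A A] [SMulCommClass ℂ A A] : BanachBimodule A A where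
  left := ContinuousLinearMap.mul ℂ A
  right := (ContinuousLinearMap.mul ℂ A).flip
  left_mul a b x := by simp [mul_assoc]
  right_mul a b x := by simp [mul_assoc]
  left_right a b x := by simp [mul_assoc]

/-- The dual bimodule `E*`, with `⟨a · f, x⟩ = ⟨f, x · a⟩` and `⟨f · a, x⟩ = ⟨f, a · x⟩`. -/
noncomputable def dual {A : Type u} [NonUnitalNormedRing A] [NormedSpace ℂ A]
    {E : Type w} [NormedAddCommGroup E] [NormedSpace ℂ E] (M : BanachBimodule A E) :
    BanachBimodule A (StrongDual ℂ E) where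
  left := (ContinuousLinearMap.compL ℂ E E ℂ).flip.comp M.right
  right := (ContinuousLinearMap.compL ℂ E E ℂ).flip.comp M.left
  left_mul a b f := by ext x; simp [M.right_mul]
  right_mul a b f := by ext x; simp [M.left_mul]
  left_right a b f := by ext x; simp [M.left_right]

theorem dual_left_apply {A : Type u} [NonUnitalNormedRing A] [NormedSpace ℂ A]
    {E : Type w} [NormedAddCommGroup E] [NormedSpace ℂ E] (M : BanachBimodule A E)
    (a : A) (f : StrongDual ℂ E) (x : E) : M.dual.left a f x = f (M.right a x) := rfl

theorem dual_right_apply {A : Type u} [NonUnitalNormedRing A] [NormedSpace ℂ A]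
    {E : Type w} [NormedAddCommGroup E] [NormedSpace ℂ E] (M : BanachBimodule A E)
    (a : A) (f : StrongDual ℂ E) (x : E) : M.dual.right a f x = f (M.left a x) := rfl

/-- The continuous linear map `D : A → E` is a derivation: `D (ab) = D a · b + a · D b`. -/
def IsDerivation {A : Type u} [NonUnitalNormedRing A] [NormedSpace ℂ A]
    {E : Type w} [NormedAddCommGroup E] [NormedSpace ℂ E] (M : BanachBimodule A E)
    (D : A →L[ℂ] E) : Prop :=
  ∀ a b : A, D (a * b) = M.right b (D a) + M.left a (D b)

/-- `D` is inner: for some `z` in `E`, `D a = a · z - z · a` for all `a`. -/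
def IsInner {A : Type u} [NonUnitalNormedRing A] [NormedSpace ℂ A]
    {E : Type w} [NormedAddCommGroup E] [NormedSpace ℂ E] (M : BanachBimodule A E)
    (D : A →L[ℂ] E) : Prop :=
  ∃ z : E, ∀ a : A, D a = M.left a z - M.right a z

end BanachBimodule

/-- `A` is amenable: for every Banach `A`-bimodule `E` (in the universe `w`), every continuous
derivation from `A` into the dual bimodule `E*` is inner. -/
def IsAmenable (A : Type u) [NonUnitalNormedRing A] [NormedSpace ℂ A] : Prop :=
  ∀ (E : Type w) [NormedAddCommGroup E] [NormedSpace ℂ E] [CompleteSpace E]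
    (M : BanachBimodule A E) (D : A →L[ℂ] StrongDual ℂ E),
    M.dual.IsDerivation D → M.dual.IsInner D

/-- `A` is weakly amenable: every continuous derivation from `A` into `A*` is inner. -/
def IsWeaklyAmenable (A : Type u) [NonUnitalNormedRing A] [NormedSpace ℂ A]
    [IsScalarTower ℂ A A] [SMulCommClass ℂ A A] : Prop :=
  ∀ D : A →L[ℂ] StrongDual ℂ A,
    (BanachBimodule.regular A).dual.IsDerivation D → (BanachBimodule.regular A).dual.IsInner D

/-- `D` is a continuous point derivation of `A` at `φ`. -/
def IsPointDerivation {A : Type u} [NonUnitalNormedRing A] [NormedSpace ℂ A]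
    (φ : WeakDual ℂ A) (D : A →L[ℂ] ℂ) : Prop :=
  ∀ a b : A, D (a * b) = D a * φ b + φ a * D b

/-- `A` is 0-point amenable: it has no non-zero continuous point derivation at any point of
`Δ(A) ∪ {0}`, where `Δ(A)` is the character space of `A`. -/
def IsZeroPointAmenable (A : Type u) [NonUnitalNormedRing A] [NormedSpace ℂ A] : Prop :=
  ∀ φ ∈ WeakDual.characterSpace ℂ A ∪ {0}, ∀ D : A →L[ℂ] ℂ, IsPointDerivation φ D → D = 0

/-! Evaluation at a point maps `C₀(X, A)` onto `A`, and all three properties pass to such images (in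
the third, by commutativity). The work lies in going from `A` to `C₀(X, A)`, and it rests on the
unimodular functions in `C_b(X)`: they span `C_b(X)`, and they form a commutative group bounded in
norm.

For (i), amenability is equivalent to the existence of a virtual diagonal `M`. For `e` in `C₀(X)`
and `u` unimodular, push `M` forward along `a ⊗ b ↦ (eu ⊗ a) ⊗ (eu* ⊗ b)`. Averaging over `u` with
an invariant mean gives a functional across which unimodular functions, together with elements of
`A`, may be moved. Its product is that of `M` damped by `e²`. A weak-* limit along an approximate
identity `e` removes the damping, and linearity and density then give a virtual diagonal of `C₀(X,
A)`.

For (ii) and (iii), `C_b(X)` has no bounded derivation `δ ≠ 0` into a symmetric module, because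
`δ(uⁿ) = n uⁿ⁻¹ δ(u)` stays bounded in `n`. Applied to commutators of `D` with multiplication by
functions, this makes `D` linear over `C_b(X)`, acting through a character in (ii). Then `D` is
controlled by derivations of `A` obtained by restricting to elementary tensors. -/

open ContinuousLinearMap Filter Topology
open scoped BoundedContinuousFunction

/-! ### Constructions of Banach bimodules -/

section QuotientLift

variable {A E F : Type*} [SeminormedAddCommGroup A] [NormedSpace ℂ A] [NormedAddCommGroup E]
  [NormedSpace ℂ E] [NormedAddCommGroup F] [NormedSpace ℂ F]

/-- A bounded bilinear map which kills a subspace in its second variable descends to the quotient. -/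
noncomputable def ContinuousLinearMap.quotientLift₂ (S : Submodule ℂ E) (B : A →L[ℂ] E →L[ℂ] F)
    (h : ∀ a, ∀ x ∈ S, B a x = 0) : A →L[ℂ] (E ⧸ S) →L[ℂ] F :=
  LinearMap.mkContinuous₂
    (LinearMap.mk₂ ℂ (fun a q => S.liftQ (B a : E →ₗ[ℂ] F) (h a) q)
      (fun a b q => by
        induction q using Submodule.Quotient.induction_on with
        | H x => exact congrArg (fun g : E →L[ℂ] F => g x) (B.map_add a b))
      (fun c a q => by
        induction q using Submodule.Quotient.induction_on with
        | H x => exact congrArg (fun g : E →L[ℂ] F => g x) (B.map_smul c a))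
      (fun a q r => by simp) (fun c a q => by simp)) ‖B‖ (by
    intro a q
    -- The quotient norm is an infimum that need not be attained, hence the `ε`; the `+ 1` below
    -- keeps the divisor positive when `‖B‖ * ‖a‖ = 0`.
    refine le_of_forall_pos_le_add fun ε hε => ?_
    have hc : 0 < ‖B‖ * ‖a‖ + 1 := by positivity
    obtain ⟨m, rfl, hm⟩ := Submodule.Quotient.norm_mk_lt q (div_pos hε hc)
    calc ‖B a m‖ ≤ ‖B‖ * ‖a‖ * ‖m‖ := B.le_opNorm₂ a m
      _ ≤ ‖B‖ * ‖a‖ * (‖(Submodule.Quotient.mk m : E ⧸ S)‖ + ε / (‖B‖ * ‖a‖ + 1)) := by gcongr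
      _ = ‖B‖ * ‖a‖ * ‖(Submodule.Quotient.mk m : E ⧸ S)‖
          + ‖B‖ * ‖a‖ * (ε / (‖B‖ * ‖a‖ + 1)) := by ring
      _ ≤ _ := by
        gcongr
        rw [mul_div_assoc', div_le_iff₀ hc]
        nlinarith)

end QuotientLift

namespace BanachBimodule

variable {A : Type u} [NonUnitalNormedRing A] [NormedSpace ℂ A]

section Constructions

variable {E F : Type*} [NormedAddCommGroup E] [NormedSpace ℂ E] [NormedAddCommGroup F]
  [NormedSpace ℂ F]

/-- The quotient of a Banach bimodule by a closed sub-bimodule. -/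
noncomputable def quotient (M : BanachBimodule A E) (S : Submodule ℂ E) [IsClosed (S : Set E)]
    (hl : ∀ a, ∀ x ∈ S, M.left a x ∈ S) (hr : ∀ a, ∀ x ∈ S, M.right a x ∈ S) :
    BanachBimodule A (E ⧸ S) where
  left := quotientLift₂ S (compL ℂ E E (E ⧸ S) S.mkQL ∘L M.left) (fun a x hx => by
    simpa using hl a x hx)
  right := quotientLift₂ S (compL ℂ E E (E ⧸ S) S.mkQL ∘L M.right) (fun a x hx => by
    simpa using hr a x hx)
  left_mul a b q := by
    induction q using Submodule.Quotient.induction_on with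
    | H x => exact congrArg _ (M.left_mul a b x)
  right_mul a b q := by
    induction q using Submodule.Quotient.induction_on with
    | H x => exact congrArg _ (M.right_mul a b x)
  left_right a b q := by
    induction q using Submodule.Quotient.induction_on with
    | H x => exact congrArg _ (M.left_right a b x)

/-- Transport of a bimodule structure along a continuous linear equivalence. -/
noncomputable def congr (M : BanachBimodule A E) (e : E ≃L[ℂ] F) : BanachBimodule A F where
  left := compL ℂ F E F e ∘L (compL ℂ F E E).flip e.symm ∘L M.left
  right := compL ℂ F E F e ∘L (compL ℂ F E E).flip e.symm ∘L M.right
  left_mul a b x := by simp [M.left_mul]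
  right_mul a b x := by simp [M.right_mul]
  left_right a b x := by simp [M.left_right]

/-- Restriction of scalars along a continuous algebra homomorphism. -/
noncomputable def pullback {B : Type*} [NonUnitalNormedRing B] [NormedSpace ℂ B]
    (M : BanachBimodule A E) (θ : B →L[ℂ] A) (hθ : ∀ a b, θ (a * b) = θ a * θ b) :
    BanachBimodule B E where
  left := M.left ∘L θ
  right := M.right ∘L θ
  left_mul a b x := by simp [hθ, M.left_mul]
  right_mul a b x := by simp [hθ, M.right_mul]
  left_right a b x := by simp [M.left_right]

end Constructions

end BanachBimodule

/-! ### Permanence of amenability and central functionals -/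

variable {A : Type u} [NonUnitalNormedRing A] [NormedSpace ℂ A]

/-- Amenability passes to the image of a continuous homomorphism. -/
theorem IsAmenable.of_surjective {B : Type*} [NonUnitalNormedRing B] [NormedSpace ℂ B]
    (hB : IsAmenable.{_, w} B) (θ : B →L[ℂ] A) (hθ : ∀ a b, θ (a * b) = θ a * θ b)
    (hs : Function.Surjective θ) : IsAmenable.{u, w} A := by
  intro E _ _ _ M D hD
  obtain ⟨z, hz⟩ := hB E (M.pullback θ hθ) (D ∘L θ) (fun a b => by
    simp only [comp_apply, hθ]
    exact hD _ _)
  refine ⟨z, fun a => ?_⟩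
  obtain ⟨b, rfl⟩ := hs a
  exact hz b

/-- Amenability tested on bimodules of a large universe can be tested on those of a small one. -/
theorem IsAmenable.descend (hA : IsAmenable.{u, max u v} A) : IsAmenable.{u, u} A := by
  intro E _ _ _ M D hD
  let e : E ≃L[ℂ] ULift.{v} E := ContinuousLinearEquiv.ulift.symm
  obtain ⟨z, hz⟩ := hA (ULift.{v} E) (M.congr e)
    ((compL ℂ (ULift.{v} E) E ℂ).flip (e.symm : ULift.{v} E →L[ℂ] E) ∘L D) (fun a b => by
      ext x
      simp [hD a b, BanachBimodule.dual_left_apply, BanachBimodule.dual_right_apply,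
        BanachBimodule.congr])
  refine ⟨z ∘L (e : E →L[ℂ] ULift.{v} E), fun a => ?_⟩
  ext x
  simpa [BanachBimodule.dual_left_apply, BanachBimodule.dual_right_apply,
        BanachBimodule.congr] using congrArg (fun f => f (e x)) (hz a)

/-- In the dual of a bimodule over an amenable algebra, a functional which commutes with the
algebra on a sub-bimodule agrees there with one that commutes with the algebra everywhere. -/
theorem IsAmenable.exists_central_extension (hA : IsAmenable.{u, w} A) {W : Type w}
    [NormedAddCommGroup W] [NormedSpace ℂ W] [CompleteSpace W] (V : BanachBimodule A W)
    {F : Type*} [NormedAddCommGroup F] [NormedSpace ℂ F] (i : F →L[ℂ] W)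
    (hl : ∀ a f, ∃ g, i g = V.left a (i f)) (hr : ∀ a f, ∃ g, i g = V.right a (i f))
    (M₀ : StrongDual ℂ W) (hM₀ : ∀ a f, M₀ (V.right a (i f)) = M₀ (V.left a (i f))) :
    ∃ M : StrongDual ℂ W, (∀ f, M (i f) = M₀ (i f)) ∧
      ∀ a x, M (V.right a x) = M (V.left a x) := by
  let S : Submodule ℂ W := (LinearMap.range (i : F →ₗ[ℂ] W)).topologicalClosure
  have hS : IsClosed (S : Set W) := Submodule.isClosed_topologicalClosure _
  have mem_S : ∀ f, i f ∈ S := fun f => Submodule.le_topologicalClosure _ ⟨f, rfl⟩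
  have extend : ∀ {G : Submodule ℂ W}, IsClosed (G : Set W) → (∀ f, i f ∈ G) → S ≤ G :=
    fun hG h => Submodule.topologicalClosure_minimal _ (by rintro _ ⟨f, rfl⟩; exact h f) hG
  have hl' : ∀ a, ∀ x ∈ S, V.left a x ∈ S := fun a => by
    refine extend (G := S.comap (V.left a : W →ₗ[ℂ] W))
      (hS.preimage (V.left a).continuous) fun f => ?_
    obtain ⟨g, hg⟩ := hl a f
    exact Submodule.mem_comap.2 (hg.subst (motive := (· ∈ S)) (mem_S g))
  have hr' : ∀ a, ∀ x ∈ S, V.right a x ∈ S := fun a => by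
    refine extend (G := S.comap (V.right a : W →ₗ[ℂ] W))
      (hS.preimage (V.right a).continuous) fun f => ?_
    obtain ⟨g, hg⟩ := hr a f
    exact Submodule.mem_comap.2 (hg.subst (motive := (· ∈ S)) (mem_S g))
  -- This is the inner derivation implemented by `M₀`. It vanishes on `S`, so it takes values in the
  -- dual of `W ⧸ S`; amenability implements it there by some `N`, and subtracting `N` from `M₀`
  -- leaves a central functional unchanged on `S`.
  let D₀ : A →L[ℂ] W →L[ℂ] ℂ := compL ℂ W W ℂ M₀ ∘L (V.right - V.left)
  have hD₀ : ∀ a x, D₀ a x = M₀ (V.right a x) - M₀ (V.left a x) := fun a x => by simp [D₀]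
  have hker : ∀ a, ∀ x ∈ S, D₀ a x = 0 := fun a => by
    refine extend (G := LinearMap.ker (D₀ a : W →ₗ[ℂ] ℂ))
      (isClosed_singleton.preimage (D₀ a).continuous) fun f => ?_
    change D₀ a (i f) = 0
    rw [hD₀, hM₀, sub_self]
  obtain ⟨N, hN⟩ := hA _ (V.quotient S hl' hr') (D₀.quotientLift₂ S hker) (fun a b => by
    ext q
    induction q using Submodule.Quotient.induction_on with
    | H x =>
      change D₀ (a * b) x = D₀ a (V.left b x) + D₀ b (V.right a x)
      rw [hD₀, hD₀, hD₀, V.left_mul, V.right_mul, V.left_right]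
      ring)
  have hN' : ∀ a x, D₀ a x = N (S.mkQL (V.right a x)) - N (S.mkQL (V.left a x)) :=
    fun a x => congrArg (fun g => g (Submodule.Quotient.mk x)) (hN a)
  refine ⟨M₀ - N ∘L S.mkQL, fun f => ?_, fun c x => ?_⟩
  · have : S.mkQL (i f) = 0 := (Submodule.Quotient.mk_eq_zero _).2 (mem_S f)
    simp only [sub_apply, comp_apply, this, map_zero, sub_zero]
  · have := hN' c x
    rw [hD₀] at this
    simp only [sub_apply, comp_apply]
    linear_combination this

/-! ### Virtual diagonals and Johnson's criterion -/

section VirtualDiagonal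

variable [IsScalarTower ℂ A A] [SMulCommClass ℂ A A]

/-- A mixed identity of the bidual: a common identity for both module actions of `A` on `A*`. -/
structure IsMixedIdentity (e : StrongDual ℂ (StrongDual ℂ A)) : Prop where
  apply_left : ∀ (f : StrongDual ℂ A) (a : A), e (f ∘L mul ℂ A a) = f a
  apply_right : ∀ (f : StrongDual ℂ A) (a : A), e (f ∘L (mul ℂ A).flip a) = f a

/-- When one action on `A*` is replaced by zero, the canonical embedding of `A` in its bidual
becomes a derivation, and a functional implementing it is a one-sided identity. -/
theorem IsAmenable.exists_right_identity (hA : IsAmenable.{u, u} A) :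
    ∃ e : StrongDual ℂ (StrongDual ℂ A), ∀ f a, e (f ∘L mul ℂ A a) = f a := by
  let M : BanachBimodule A (StrongDual ℂ A) :=
    { left := 0
      right := (compL ℂ A A ℂ).flip ∘L mul ℂ A
      left_mul := by simp
      right_mul := fun a b x => by ext; simp [mul_assoc]
      left_right := by simp }
  obtain ⟨z, hz⟩ := hA _ M (NormedSpace.inclusionInDoubleDual ℂ A) (fun a b => by
    ext f
    simp [BanachBimodule.dual_left_apply, BanachBimodule.dual_right_apply, M])
  refine ⟨z, fun f a => ?_⟩
  simpa [BanachBimodule.dual_left_apply, BanachBimodule.dual_right_apply, M] using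
    (congrArg (fun g => g f) (hz a)).symm

theorem IsAmenable.exists_left_identity (hA : IsAmenable.{u, u} A) :
    ∃ e : StrongDual ℂ (StrongDual ℂ A), ∀ f a, e (f ∘L (mul ℂ A).flip a) = f a := by
  let M : BanachBimodule A (StrongDual ℂ A) :=
    { left := (compL ℂ A A ℂ).flip ∘L (mul ℂ A).flip
      right := 0
      left_mul := fun a b x => by ext; simp [mul_assoc]
      right_mul := by simp
      left_right := by simp }
  obtain ⟨z, hz⟩ := hA _ M (NormedSpace.inclusionInDoubleDual ℂ A) (fun a b => by
    ext f
    simp [BanachBimodule.dual_left_apply, BanachBimodule.dual_right_apply, M])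
  -- Only the term `-z · a` of the inner derivation survives, hence the sign.
  refine ⟨-z, fun f a => ?_⟩
  simpa [BanachBimodule.dual_left_apply, BanachBimodule.dual_right_apply, M] using
    (congrArg (fun g => g f) (hz a)).symm

theorem IsAmenable.exists_isMixedIdentity (hA : IsAmenable.{u, u} A) :
    ∃ e : StrongDual ℂ (StrongDual ℂ A), IsMixedIdentity e := by
  obtain ⟨r, hr⟩ := hA.exists_right_identity
  obtain ⟨l, hl⟩ := hA.exists_left_identity
  -- This is `1 - (1 - r)(1 - l)` expanded, with `r l` the first Arens product `f ↦ r (x ↦ l (y ↦ f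
  -- (x y)))`.
  refine ⟨r + l - r ∘L (compL ℂ A (StrongDual ℂ A) ℂ l ∘L
    (compL ℂ A (A →L[ℂ] A) (StrongDual ℂ A)).flip (mul ℂ A) ∘L compL ℂ A A ℂ), ?_, ?_⟩
  · intro f a
    have h : compL ℂ A (StrongDual ℂ A) ℂ l ((compL ℂ A A ℂ (f ∘L mul ℂ A a)) ∘L mul ℂ A) =
        (compL ℂ A (StrongDual ℂ A) ℂ l ((compL ℂ A A ℂ f) ∘L mul ℂ A)) ∘L mul ℂ A a := by
      ext x
      simp only [compL_apply, comp_apply]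
      congr 1
      ext y
      simp [mul_assoc]
    simp only [sub_apply, add_apply, comp_apply, flip_apply, compL_apply] at h ⊢
    rw [h, hr, hr]
    simp only [comp_apply, compL_apply]
    ring
  · intro f a
    have h : compL ℂ A (StrongDual ℂ A) ℂ l
        ((compL ℂ A A ℂ (f ∘L (mul ℂ A).flip a)) ∘L mul ℂ A) = f ∘L (mul ℂ A).flip a := by
      ext x
      simp only [compL_apply, comp_apply, flip_apply]
      have : (f ∘L (mul ℂ A).flip a) ∘L mul ℂ A x = (f ∘L mul ℂ A x) ∘L (mul ℂ A).flip a := by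
        ext y
        simp [mul_assoc]
      rw [this, hl]
      simp
    simp only [sub_apply, add_apply, comp_apply, flip_apply, compL_apply] at h ⊢
    rw [h, hl]
    ring

/-- The bimodule of bounded bilinear forms on `A`, the dual of the projective tensor square:
`(c · T)(a, b) = T(a, b c)` and `(T · c)(a, b) = T(c a, b)`. -/
noncomputable def BanachBimodule.bilinear (A : Type u) [NonUnitalNormedRing A] [NormedSpace ℂ A]
    [IsScalarTower ℂ A A] [SMulCommClass ℂ A A] : BanachBimodule A (A →L[ℂ] A →L[ℂ] ℂ) where
  left := compL ℂ A (A →L[ℂ] ℂ) (A →L[ℂ] ℂ) ∘L (compL ℂ A A ℂ).flip ∘L (mul ℂ A).flip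
  right := (compL ℂ A A (A →L[ℂ] ℂ)).flip ∘L mul ℂ A
  left_mul a b T := by ext; simp [mul_assoc]
  right_mul a b T := by ext; simp [mul_assoc]
  left_right a b T := by ext; simp

@[simp]
theorem BanachBimodule.bilinear_left_apply (c : A) (T : A →L[ℂ] A →L[ℂ] ℂ) (a b : A) :
    (BanachBimodule.bilinear A).left c T a b = T a (b * c) := rfl

@[simp]
theorem BanachBimodule.bilinear_right_apply (c : A) (T : A →L[ℂ] A →L[ℂ] ℂ) (a b : A) :
    (BanachBimodule.bilinear A).right c T a b = T (c * a) b := rfl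

/-- The adjoint `f ↦ ((a, b) ↦ f (a b))` of the product map. -/
noncomputable def mulAdjoint (A : Type u) [NonUnitalNormedRing A] [NormedSpace ℂ A]
    [IsScalarTower ℂ A A] [SMulCommClass ℂ A A] :
    StrongDual ℂ A →L[ℂ] A →L[ℂ] A →L[ℂ] ℂ :=
  (compL ℂ A (A →L[ℂ] A) (StrongDual ℂ A)).flip (mul ℂ A) ∘L compL ℂ A A ℂ

@[simp]
theorem mulAdjoint_apply (f : StrongDual ℂ A) (a b : A) : mulAdjoint A f a b = f (a * b) := rfl

/-- A virtual diagonal: a functional on the bounded bilinear forms which commutes with `A` and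
whose product is a mixed identity. -/
structure IsVirtualDiagonal (M : StrongDual ℂ (A →L[ℂ] A →L[ℂ] ℂ)) : Prop where
  comm : ∀ (c : A) (T : A →L[ℂ] A →L[ℂ] ℂ),
    M ((BanachBimodule.bilinear A).right c T) = M ((BanachBimodule.bilinear A).left c T)
  product : ∀ (f : StrongDual ℂ A) (c : A), M (mulAdjoint A (f ∘L (mul ℂ A).flip c)) = f c

theorem IsVirtualDiagonal.isMixedIdentity {M : StrongDual ℂ (A →L[ℂ] A →L[ℂ] ℂ)}
    (hM : IsVirtualDiagonal M) : IsMixedIdentity (M ∘L mulAdjoint A) where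
  apply_right f a := hM.product f a
  apply_left f a := by
    rw [← hM.product f a, comp_apply]
    have h₁ : mulAdjoint A (f ∘L mul ℂ A a) =
        (BanachBimodule.bilinear A).right a (mulAdjoint A f) := by ext; simp [mul_assoc]
    have h₂ : mulAdjoint A (f ∘L (mul ℂ A).flip a) =
        (BanachBimodule.bilinear A).left a (mulAdjoint A f) := by ext; simp [mul_assoc]
    rw [h₁, h₂, hM.comm]

/-- For a mixed identity `e`, the functional `e ⊗ e` has the right product but need not commute with
`A`. It does so on the forms `(a, b) ↦ f (a b)`, and these are all that the product condition sees,
so `exists_central_extension` corrects it. -/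
theorem IsAmenable.exists_isVirtualDiagonal (hA : IsAmenable.{u, u} A) :
    ∃ M : StrongDual ℂ (A →L[ℂ] A →L[ℂ] ℂ), IsVirtualDiagonal M := by
  obtain ⟨e, he⟩ := hA.exists_isMixedIdentity
  let M₀ : StrongDual ℂ (A →L[ℂ] A →L[ℂ] ℂ) := e ∘L compL ℂ A (StrongDual ℂ A) ℂ e
  have hM₀ : ∀ f c, M₀ (mulAdjoint A (f ∘L (mul ℂ A).flip c)) = f c := fun f c => by
    have : compL ℂ A (StrongDual ℂ A) ℂ e (mulAdjoint A (f ∘L (mul ℂ A).flip c)) =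
        f ∘L (mul ℂ A).flip c := by
      ext x
      have h : mulAdjoint A (f ∘L (mul ℂ A).flip c) x = (f ∘L mul ℂ A x) ∘L (mul ℂ A).flip c := by
        ext; simp [mul_assoc]
      simp only [compL_apply, comp_apply, h, he.apply_right]
      simp
    simp only [M₀, comp_apply, this, he.apply_right]
  have hM₀' : ∀ f c, M₀ (mulAdjoint A (f ∘L mul ℂ A c)) = f c := fun f c => by
    have : compL ℂ A (StrongDual ℂ A) ℂ e (mulAdjoint A (f ∘L mul ℂ A c)) =
        f ∘L mul ℂ A c := by
      ext x
      have h : mulAdjoint A (f ∘L mul ℂ A c) x = f ∘L mul ℂ A (c * x) := by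
        ext; simp [mul_assoc]
      simp only [compL_apply, comp_apply, h, he.apply_left]
      simp
    simp only [M₀, comp_apply, this, he.apply_left]
  have hl : ∀ a f, (BanachBimodule.bilinear A).left a (mulAdjoint A f) =
      mulAdjoint A (f ∘L (mul ℂ A).flip a) := fun a f => by ext; simp [mul_assoc]
  have hr : ∀ a f, (BanachBimodule.bilinear A).right a (mulAdjoint A f) =
      mulAdjoint A (f ∘L mul ℂ A a) := fun a f => by ext; simp [mul_assoc]
  obtain ⟨M, hM, hMc⟩ := hA.exists_central_extension (BanachBimodule.bilinear A) (mulAdjoint A)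
    (fun a f => ⟨_, (hl a f).symm⟩) (fun a f => ⟨_, (hr a f).symm⟩) M₀
    (fun a f => by rw [hl, hr, hM₀, hM₀'])
  exact ⟨M, hMc, fun f c => by rw [hM, hM₀]⟩

/-- If `M` were `∑ aᵢ ⊗ bᵢ`, then `z = ∑ aᵢ · D bᵢ` would implement `D` on an essential module. In
general it leaves a remainder `D₁` vanishing on `E · A`, which the mixed identity shows to be inner
as well. -/
theorem IsVirtualDiagonal.isAmenable {M : StrongDual ℂ (A →L[ℂ] A →L[ℂ] ℂ)}
    (hM : IsVirtualDiagonal M) : IsAmenable.{u, w} A := by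
  intro E _ _ _ V D hD
  have hD' : ∀ a b x, D (a * b) x = D a (V.left b x) + D b (V.right a x) :=
    fun a b x => congrArg (fun g => g x) (hD a b)
  set e := M ∘L mulAdjoint A
  have he : IsMixedIdentity e := hM.isMixedIdentity
  -- `β x (a, b) = D b (x · a)`
  let β : E →L[ℂ] A →L[ℂ] A →L[ℂ] ℂ := (compL ℂ A E (A →L[ℂ] ℂ) D.flip) ∘L V.right.flip
  have hβ : ∀ x a b, β x a b = D b (V.right a x) := fun x a b => rfl
  let z : StrongDual ℂ E := M ∘L β
  let D₁ : A →L[ℂ] StrongDual ℂ E := D - (V.dual.left.flip z - V.dual.right.flip z)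
  have hD₁ : ∀ c x, D₁ c x = D c x - (z (V.right c x) - z (V.left c x)) := fun c x => rfl
  have hz : ∀ c x, z (V.right c x) - z (V.left c x) = e (D c ∘L V.right.flip x) := by
    intro c x
    have h₁ : β (V.right c x) = (BanachBimodule.bilinear A).right c (β x) := by
      ext a b; simp [hβ, V.right_mul]
    have h₂ : (BanachBimodule.bilinear A).left c (β x) =
        β (V.left c x) + mulAdjoint A (D c ∘L V.right.flip x) := by
      ext a b
      simp [hβ, hD', V.right_mul, V.left_right]
    simp only [z, e, comp_apply]
    rw [h₁, hM.comm, h₂, map_add]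
    ring
  have hkill : ∀ c a x, D₁ c (V.right a x) = 0 := by
    intro c a x
    rw [hD₁, hz]
    have : D c ∘L V.right.flip (V.right a x) = (D c ∘L V.right.flip x) ∘L mul ℂ A a := by
      ext b; simp [V.right_mul]
    rw [this, he.apply_left]
    simp
  have hmod : ∀ a b x, D₁ (a * b) x = D₁ a (V.left b x) := by
    intro a b x
    have : D₁ (a * b) x = D₁ a (V.left b x) + D₁ b (V.right a x) := by
      simp only [hD₁, hD', V.left_mul, V.right_mul, V.left_right]
      ring
    rw [this, hkill, add_zero]
  -- Since `D₁ (a b) = D₁ a · b` and `a · D₁ b = 0`, applying `e` to `a ↦ D₁ a` gives `w · c = D₁ c`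
  -- and `c · w = 0`; thus `-w` implements `D₁`.
  let w : StrongDual ℂ E := e ∘L D₁.flip
  refine ⟨z - w, fun c => ?_⟩
  ext x
  have hw₁ : w (V.right c x) = 0 := by
    have : D₁.flip (V.right c x) = 0 := by ext a; simp [hkill]
    simp only [w, comp_apply, this, map_zero]
  have hw₂ : w (V.left c x) = D₁ c x := by
    have : D₁.flip (V.left c x) = D₁.flip x ∘L (mul ℂ A).flip c := by ext a; simp [hmod]
    simp only [w, comp_apply, this, he.apply_right]
    rfl
  simp only [sub_apply, map_sub, BanachBimodule.dual_left_apply, BanachBimodule.dual_right_apply,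
    hw₁, hw₂, hD₁]
  ring

end VirtualDiagonal

/-! ### The space `C₀(X, E)`: module structure, elementary tensors, density -/

namespace ZeroAtInftyContinuousMap

variable {X : Type*} [TopologicalSpace X]

section Norm

variable {E : Type*} [NormedAddCommGroup E]

theorem norm_apply_le (f : C₀(X, E)) (x : X) : ‖f x‖ ≤ ‖f‖ := f.toBCF.norm_coe_le_norm x

theorem norm_le_of_forall {f : C₀(X, E)} {C : ℝ} (hC : 0 ≤ C) (h : ∀ x, ‖f x‖ ≤ C) : ‖f‖ ≤ C :=
  (BoundedContinuousFunction.norm_le (f := f.toBCF) hC).2 h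

theorem exists_isCompact_norm_lt (f : C₀(X, E)) {ε : ℝ} (hε : 0 < ε) :
    ∃ K : Set X, IsCompact K ∧ ∀ x ∉ K, ‖f x‖ < ε := by
  have := (zero_at_infty f).eventually (Metric.ball_mem_nhds (0 : E) hε)
  obtain ⟨K, hK, hKf⟩ := mem_cocompact.1 this
  exact ⟨K, hK, fun x hx => by simpa using hKf hx⟩

end Norm

section Module

variable {E : Type*} [NormedAddCommGroup E] [NormedSpace ℂ E]

/-- The function `x ↦ h x • f x`, for `h` bounded and `f` vanishing at infinity. -/
noncomputable def boundedSMulFun (h : X →ᵇ ℂ) (f : C₀(X, E)) : C₀(X, E) where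
  toFun x := h x • f x
  continuous_toFun := h.continuous.smul (map_continuous f)
  zero_at_infty' := by
    have := (zero_at_infty f).norm.const_mul ‖h‖
    rw [norm_zero, mul_zero] at this
    refine squeeze_zero_norm (fun x => ?_) this
    rw [norm_smul]
    gcongr
    exact h.norm_coe_le_norm x

/-- The action of the bounded continuous functions on `C₀(X, E)` by pointwise multiplication. -/
noncomputable def boundedSMul : (X →ᵇ ℂ) →L[ℂ] C₀(X, E) →L[ℂ] C₀(X, E) :=
  LinearMap.mkContinuous₂
    (LinearMap.mk₂ ℂ boundedSMulFun (fun h k f => by ext x; exact add_smul _ _ _)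
      (fun c h f => by ext x; exact mul_smul _ _ _)
      (fun h f g => by ext x; exact smul_add _ _ _)
      (fun c h f => by ext x; exact smul_comm _ _ _)) 1
    (fun h f => norm_le_of_forall (by positivity) fun x => by
      change ‖h x • f x‖ ≤ _
      rw [norm_smul, one_mul]
      exact mul_le_mul (h.norm_coe_le_norm x) (norm_apply_le f x) (norm_nonneg _) (norm_nonneg _))

@[simp]
theorem boundedSMul_apply (h : X →ᵇ ℂ) (f : C₀(X, E)) (x : X) :
    boundedSMul h f x = h x • f x := rfl

theorem boundedSMul_mul (h k : X →ᵇ ℂ) (f : C₀(X, E)) :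
    boundedSMul (h * k) f = boundedSMul h (boundedSMul k f) := by
  ext x; simp [mul_smul]

theorem boundedSMul_comm (h k : X →ᵇ ℂ) (f : C₀(X, E)) :
    boundedSMul h (boundedSMul k f) = boundedSMul k (boundedSMul h f) := by
  rw [← boundedSMul_mul, mul_comm, boundedSMul_mul]

@[simp]
theorem boundedSMul_one (f : C₀(X, E)) : boundedSMul (1 : X →ᵇ ℂ) f = f := by
  ext x; simp

theorem norm_boundedSMul_le (h : X →ᵇ ℂ) (f : C₀(X, E)) : ‖boundedSMul h f‖ ≤ ‖h‖ * ‖f‖ :=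
  norm_le_of_forall (by positivity) fun x => by
    rw [boundedSMul_apply, norm_smul]
    exact mul_le_mul (h.norm_coe_le_norm x) (norm_apply_le f x) (norm_nonneg _) (norm_nonneg _)

/-- The elementary tensor `x ↦ h x • a`. -/
noncomputable def tensorFun (h : C₀(X, ℂ)) (a : E) : C₀(X, E) where
  toFun x := h x • a
  continuous_toFun := (map_continuous h).smul continuous_const
  zero_at_infty' := by simpa using (zero_at_infty h).smul_const a

/-- The elementary tensors `x ↦ h x • a`, as a bounded bilinear map. -/
noncomputable def tensor : C₀(X, ℂ) →L[ℂ] E →L[ℂ] C₀(X, E) :=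
  LinearMap.mkContinuous₂
    (LinearMap.mk₂ ℂ tensorFun (fun h k f => by ext x; exact add_smul _ _ _)
      (fun c h f => by ext x; exact mul_smul _ _ _)
      (fun h f g => by ext x; exact smul_add _ _ _)
      (fun c h f => by ext x; exact smul_comm _ _ _)) 1
    (fun h a => norm_le_of_forall (by positivity) fun x => by
      change ‖h x • a‖ ≤ _
      rw [norm_smul, one_mul]
      gcongr
      exact norm_apply_le h x)

@[simp]
theorem tensor_apply (h : C₀(X, ℂ)) (a : E) (x : X) : tensor h a x = h x • a := rfl

theorem norm_tensor_le (h : C₀(X, ℂ)) (a : E) : ‖tensor h a‖ ≤ ‖h‖ * ‖a‖ :=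
  norm_le_of_forall (by positivity) fun x => by
    rw [tensor_apply, norm_smul]
    gcongr
    exact norm_apply_le h x

theorem boundedSMul_toBCF_tensor (h k : C₀(X, ℂ)) (a : E) :
    boundedSMul h.toBCF (tensor k a) = tensor (h * k) a := by
  ext x; simp [mul_smul]

theorem boundedSMul_tensor (h : X →ᵇ ℂ) (k : C₀(X, ℂ)) (a : E) :
    boundedSMul h (tensor k a) = tensor (boundedSMul h k) a := by
  ext x; simp [mul_smul]

/-- Evaluation at a point. -/
noncomputable def evalCLM (x : X) : C₀(X, E) →L[ℂ] E :=
  LinearMap.mkContinuous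
    { toFun f := f x
      map_add' _ _ := rfl
      map_smul' _ _ := rfl } 1 (fun f => by rw [one_mul]; exact norm_apply_le f x)

@[simp]
theorem evalCLM_apply (x : X) (f : C₀(X, E)) : evalCLM x f = f x := rfl

/-- A continuous linear map on the bounded continuous functions is determined by its values on
unimodular functions. -/
theorem _root_.BoundedContinuousFunction.ext_unitary {F : Type*} [AddCommGroup F] [Module ℂ F]
    {S T : (X →ᵇ ℂ) →ₗ[ℂ] F}
    (h : ∀ u ∈ unitary (X →ᵇ ℂ), S u = T u) : S = T :=
  LinearMap.ext_on (CStarAlgebra.span_unitary (X →ᵇ ℂ)) h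

variable [LocallyCompactSpace X] [T2Space X]

theorem exists_eqOn_one {K : Set X} (hK : IsCompact K) :
    ∃ e : C₀(X, ℂ), ‖e‖ ≤ 1 ∧ (∀ x ∈ K, e x = 1) ∧ ∀ x, ‖1 - e x‖ ≤ 1 := by
  obtain ⟨f, hf, -, hc, hb⟩ := exists_continuous_one_zero_of_isCompact hK isClosed_empty
    (Set.disjoint_empty K)
  let e : C₀(X, ℂ) := ⟨⟨fun x => (f x : ℂ), by fun_prop⟩,
    (hc.comp_left (g := ((↑) : ℝ → ℂ)) Complex.ofReal_zero).is_zero_at_infty⟩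
  have he : ∀ x, e x = (f x : ℂ) := fun x => rfl
  refine ⟨e, norm_le_of_forall zero_le_one fun x => ?_, fun x hx => ?_, fun x => ?_⟩
  · rw [he, Complex.norm_real, Real.norm_of_nonneg (hb x).1]
    exact (hb x).2
  · rw [he, hf hx]; simp
  · rw [he, ← Complex.ofReal_one, ← Complex.ofReal_sub, Complex.norm_real,
      Real.norm_of_nonneg (sub_nonneg.2 (hb x).2)]
    linarith [(hb x).1]

theorem evalCLM_surjective (x : X) : Function.Surjective (evalCLM x : C₀(X, E) → E) := by
  intro a
  obtain ⟨e, -, he, -⟩ := exists_eqOn_one (isCompact_singleton (x := x))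
  exact ⟨tensor e a, by simp [he x rfl]⟩

variable (X) in
/-- A net of norm at most one in `C₀(X)` which is an approximate identity for every `C₀(X, E)`. -/
theorem exists_approximate_identity : ∃ e : TopologicalSpace.Compacts X → C₀(X, ℂ),
    (∀ K, ‖e K‖ ≤ 1) ∧ ∀ {E : Type w} [NormedAddCommGroup E] [NormedSpace ℂ E] (f : C₀(X, E)),
      Tendsto (fun K => boundedSMul (e K).toBCF f) atTop (𝓝 f) := by
  choose e he he₁ he₂ using fun K : TopologicalSpace.Compacts X => exists_eqOn_one K.isCompact
  refine ⟨e, he, fun {E _ _} f => ?_⟩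
  rw [Metric.tendsto_atTop]
  intro ε hε
  obtain ⟨K, hK, hKf⟩ := exists_isCompact_norm_lt f (half_pos hε)
  refine ⟨⟨K, hK⟩, fun L hL => ?_⟩
  rw [dist_comm, dist_eq_norm]
  refine (norm_le_of_forall (half_pos hε).le fun x => ?_).trans_lt (half_lt_self hε)
  have : (f - boundedSMul (e L).toBCF f) x = (1 - e L x) • f x := by
    simp [sub_smul]
  rw [this, norm_smul]
  by_cases hx : x ∈ K
  · rw [he₁ L x (hL hx), sub_self, norm_zero, zero_mul]
    exact (half_pos hε).le
  · calc ‖1 - e L x‖ * ‖f x‖ ≤ 1 * ‖f x‖ := by gcongr; exact he₂ L x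
      _ ≤ ε / 2 := by rw [one_mul]; exact (hKf x hx).le

/-- The elementary tensors span a dense subspace of `C₀(X, E)`. -/
theorem dense_span_tensor :
    Dense (Submodule.span ℂ {f : C₀(X, E) | ∃ h a, tensor h a = f} : Set C₀(X, E)) := by
  intro f
  rw [Metric.mem_closure_iff]
  intro ε hε
  obtain ⟨K, hK, hKf⟩ := exists_isCompact_norm_lt f (half_pos hε)
  obtain ⟨t, ht⟩ := hK.elim_finite_subcover (fun x => {y | ‖f y - f x‖ < ε / 2})
    (fun x => isOpen_lt (by fun_prop) continuous_const)
    (fun x _ => Set.mem_iUnion.2 ⟨x, by simpa using hε⟩)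
  obtain ⟨ρ, hρ, hρc⟩ := PartitionOfUnity.exists_isSubordinate_of_locallyFinite_t2space hK
    (fun i : t => {y | ‖f y - f i‖ < ε / 2}) (fun i => isOpen_lt (by fun_prop) continuous_const)
    (locallyFinite_of_finite _) (fun x hx => by simpa using ht hx)
  let r : t → C₀(X, ℂ) := fun i => ⟨⟨fun x => (ρ i x : ℂ), by fun_prop⟩,
    ((hρc i).comp_left (g := ((↑) : ℝ → ℂ)) Complex.ofReal_zero).is_zero_at_infty⟩
  have hr : ∀ i x, r i x = (ρ i x : ℂ) := fun i x => rfl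
  refine ⟨∑ i, tensor (r i) (f i), Submodule.sum_mem _ fun i _ =>
    Submodule.subset_span ⟨_, _, rfl⟩, ?_⟩
  rw [dist_eq_norm]
  refine (norm_le_of_forall (half_pos hε).le fun x => ?_).trans_lt (half_lt_self hε)
  have hsum : ∑ i, ρ i x ≤ 1 := by
    rw [← finsum_eq_sum_of_fintype]; exact ρ.sum_le_one x
  -- The first sum is small because `ρ i` lives where `f` is close to `f i`; the last term vanishes
  -- on `K`, and off `K` the function `f` is small.
  have key : (f - ∑ i, tensor (r i) (f i)) x =
      ∑ i, (ρ i x : ℂ) • (f x - f i) + ((1 - ∑ i, ρ i x : ℝ) : ℂ) • f x := by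
    have h : (∑ i, tensor (r i) (f i)) x = ∑ i, (ρ i x : ℂ) • f i := by
      rw [← evalCLM_apply, map_sum]
      rfl
    rw [sub_apply, h]
    simp only [smul_sub, Finset.sum_sub_distrib, ← Finset.sum_smul]
    push_cast
    rw [sub_smul, one_smul]
    abel
  have h₁ : ∀ i, ‖(ρ i x : ℂ) • (f x - f i)‖ ≤ ρ i x * (ε / 2) := by
    intro i
    rw [norm_smul, Complex.norm_real, Real.norm_of_nonneg (ρ.nonneg i x)]
    by_cases hx : ρ i x = 0
    · simp [hx]
    · have : x ∈ {y | ‖f y - f i‖ < ε / 2} := hρ i (subset_tsupport _ hx)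
      exact mul_le_mul_of_nonneg_left this.le (ρ.nonneg i x)
  have h₂ : ‖((1 - ∑ i, ρ i x : ℝ) : ℂ) • f x‖ ≤ (1 - ∑ i, ρ i x) * (ε / 2) := by
    rw [norm_smul, Complex.norm_real, Real.norm_of_nonneg (sub_nonneg.2 hsum)]
    by_cases hx : x ∈ K
    · have := ρ.sum_eq_one hx
      rw [finsum_eq_sum_of_fintype] at this
      rw [this]
      simp
    · exact mul_le_mul_of_nonneg_left (hKf x hx).le (sub_nonneg.2 hsum)
  rw [key]
  calc _ ≤ ∑ i, ρ i x * (ε / 2) + (1 - ∑ i, ρ i x) * (ε / 2) :=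
        (norm_add_le _ _).trans (add_le_add (norm_sum_le_of_le _ fun i _ => h₁ i) h₂)
    _ = ε / 2 := by rw [← Finset.sum_mul]; ring

theorem ext_tensor {F : Type*} [NormedAddCommGroup F] [NormedSpace ℂ F]
    {S T : C₀(X, E) →L[ℂ] F} (h : ∀ k a, S (tensor k a) = T (tensor k a)) : S = T :=
  ContinuousLinearMap.ext_on dense_span_tensor (by rintro _ ⟨k, a, rfl⟩; exact h k a)

theorem ext_boundedSMul {E : Type w} [NormedAddCommGroup E] [NormedSpace ℂ E]
    {F : Type*} [NormedAddCommGroup F] [NormedSpace ℂ F]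
    {S T : C₀(X, E) →L[ℂ] F}
    (h : ∀ (k : C₀(X, ℂ)) f, S (boundedSMul k.toBCF f) = T (boundedSMul k.toBCF f)) : S = T := by
  obtain ⟨e, -, he⟩ := exists_approximate_identity.{w} X
  ext f
  refine tendsto_nhds_unique ((S.continuous.tendsto f).comp (he f)) ?_
  simpa only [Function.comp_def, h] using (T.continuous.tendsto f).comp (he f)

/-- Factored functions `k * l` are what allows `(k * l) ⊗ (a * b)` to be split as a product in
`C₀(X, A)`. -/
theorem ext_tensor_mul {E : Type w} [NormedAddCommGroup E] [NormedSpace ℂ E]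
    {F : Type*} [NormedAddCommGroup F] [NormedSpace ℂ F]
    {S T : C₀(X, E) →L[ℂ] F} (h : ∀ k l a, S (tensor (k * l) a) = T (tensor (k * l) a)) :
    S = T :=
  ext_boundedSMul fun k f => by
    have : S ∘L boundedSMul k.toBCF = T ∘L boundedSMul k.toBCF := ext_tensor fun l a => by
      simp [boundedSMul_toBCF_tensor, h]
    exact congrArg (fun g => g f) this

end Module

section Ring

variable {A : Type*} [NonUnitalNormedRing A] [NormedSpace ℂ A]

theorem tensor_mul_tensor [IsScalarTower ℂ A A] [SMulCommClass ℂ A A] (h k : C₀(X, ℂ)) (a b : A) :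
    tensor h a * tensor k b = tensor (h * k) (a * b) := by
  ext x; simp [smul_mul_smul_comm]

theorem boundedSMul_mul_left [IsScalarTower ℂ A A] (h : X →ᵇ ℂ) (f g : C₀(X, A)) :
    boundedSMul h (f * g) = boundedSMul h f * g := by
  ext x; simp [smul_mul_assoc]

theorem boundedSMul_mul_right [SMulCommClass ℂ A A] (h : X →ᵇ ℂ) (f g : C₀(X, A)) :
    boundedSMul h (f * g) = f * boundedSMul h g := by
  ext x; simp [mul_smul_comm]

end Ring

end ZeroAtInftyContinuousMap

/-! ### Derivations of `C_b(X)` vanish -/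

section Rotation

variable {X : Type*} [TopologicalSpace X]

theorem BoundedContinuousFunction.norm_le_one_of_mem_unitary {u : X →ᵇ ℂ}
    (hu : u ∈ unitary (X →ᵇ ℂ)) : ‖u‖ ≤ 1 := by
  refine (BoundedContinuousFunction.norm_le zero_le_one).2 fun x => ?_
  have h : star (u x) * u x = 1 := congrArg (fun f : X →ᵇ ℂ => f x) (Unitary.star_mul_self_of_mem hu)
  have h' := congrArg norm h
  rw [norm_mul, norm_star, norm_one] at h'
  nlinarith [norm_nonneg (u x)]

/-- The algebra of bounded continuous functions has no non-zero bounded derivation into a symmetric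
Banach module. -/
theorem BoundedContinuousFunction.derivation_eq_zero {W : Type*} [NormedAddCommGroup W]
    [NormedSpace ℂ W] (ρ : (X →ᵇ ℂ) →L[ℂ] W →L[ℂ] W)
    (ρ_mul : ∀ h k w, ρ (h * k) w = ρ h (ρ k w)) (ρ_one : ∀ w, ρ 1 w = w)
    (δ : (X →ᵇ ℂ) →L[ℂ] W) (hδ : ∀ h k, δ (h * k) = ρ h (δ k) + ρ k (δ h)) : δ = 0 := by
  suffices H : ∀ u ∈ unitary (X →ᵇ ℂ), δ u = 0 by
    have : (δ : (X →ᵇ ℂ) →ₗ[ℂ] W) = 0 := ext_unitary H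
    ext h
    exact congrArg (fun g => g h) this
  intro u hu
  -- The left side is bounded in `n` because `u` is unimodular, while applying `star u ^ n` to the
  -- right side leaves `(n + 1) • δ u`.
  have hpow : ∀ n : ℕ, δ (u ^ (n + 1)) = ((n : ℂ) + 1) • ρ (u ^ n) (δ u) := by
    intro n
    induction n with
    | zero => simp [ρ_one]
    | succ n ih =>
      rw [pow_succ' u (n + 1), hδ, ih, map_smul, ← ρ_mul, ← pow_succ']
      push_cast
      module
  have hback : ∀ n : ℕ, ρ (star u ^ n) (δ (u ^ (n + 1))) = ((n : ℂ) + 1) • δ u := by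
    intro n
    rw [hpow, map_smul, ← ρ_mul, ← mul_pow, Unitary.star_mul_self_of_mem hu, one_pow, ρ_one]
  have hbound : ∀ n : ℕ, ((n : ℝ) + 1) * ‖δ u‖ ≤ ‖ρ‖ * ‖δ‖ := by
    intro n
    have h₁ := norm_le_one_of_mem_unitary (pow_mem (Unitary.star_mem hu) n)
    have h₂ := norm_le_one_of_mem_unitary (pow_mem hu (n + 1))
    calc ((n : ℝ) + 1) * ‖δ u‖ = ‖ρ (star u ^ n) (δ (u ^ (n + 1)))‖ := by
          rw [hback, norm_smul]
          congr 1
          simpa using (Complex.norm_natCast (n + 1)).symm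
      _ ≤ ‖ρ‖ * ‖star u ^ n‖ * ‖δ (u ^ (n + 1))‖ := ρ.le_opNorm₂ _ _
      _ ≤ ‖ρ‖ * 1 * (‖δ‖ * 1) := by
          gcongr
          exact (δ.le_opNorm _).trans (by gcongr)
      _ = ‖ρ‖ * ‖δ‖ := by ring
  by_contra hne
  obtain ⟨n, hn⟩ := exists_nat_gt (‖ρ‖ * ‖δ‖ / ‖δ u‖)
  rw [div_lt_iff₀ (norm_pos_iff.2 hne)] at hn
  nlinarith [hbound n, norm_nonneg (δ u)]

/-- A bounded map `D : E → F` between Banach `C_b(X)`-modules is a module map as soon as all the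
commutators `x ↦ D (h x) - h (D x)` are module maps. -/
theorem BoundedContinuousFunction.map_smul_of_commutator {E F : Type*} [NormedAddCommGroup E]
    [NormedSpace ℂ E] [NormedAddCommGroup F] [NormedSpace ℂ F]
    (σ : (X →ᵇ ℂ) →L[ℂ] E →L[ℂ] E) (σ_mul : ∀ h k x, σ (h * k) x = σ h (σ k x))
    (τ : (X →ᵇ ℂ) →L[ℂ] F →L[ℂ] F) (τ_mul : ∀ h k x, τ (h * k) x = τ h (τ k x))
    (τ_one : ∀ x, τ 1 x = x) (D : E →L[ℂ] F)
    (hD : ∀ h k x, D (σ h (σ k x)) - τ h (D (σ k x)) = τ k (D (σ h x) - τ h (D x)))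
    (h : X →ᵇ ℂ) (x : E) : D (σ h x) = τ h (D x) := by
  let ρ : (X →ᵇ ℂ) →L[ℂ] (E →L[ℂ] F) →L[ℂ] (E →L[ℂ] F) := compL ℂ E F F ∘L τ
  have hρ : ∀ h (S : E →L[ℂ] F) x, ρ h S x = τ h (S x) := fun _ _ _ => rfl
  -- The commutator satisfies `[D, hk] = [D, h] k + h [D, k]`, and `hD` moves `k` to the left of
  -- `[D, h]`; so `T` is a derivation into a symmetric module.
  let T : (X →ᵇ ℂ) →L[ℂ] E →L[ℂ] F := compL ℂ E E F D ∘L σ - ρ.flip D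
  have hT : ∀ h x, T h x = D (σ h x) - τ h (D x) := fun _ _ => rfl
  have hT0 : T = 0 := by
    refine derivation_eq_zero ρ (fun h k S => ?_) (fun S => ?_) T fun h k => ?_
    · ext x
      rw [hρ, hρ, hρ, τ_mul]
    · ext x
      rw [hρ, τ_one]
    · ext x
      change T (h * k) x = ρ h (T k) x + ρ k (T h) x
      rw [hρ, hρ, hT, hT, hT, ← hD h k x, σ_mul, τ_mul, map_sub]
      abel
  rw [← sub_eq_zero, ← hT, hT0]
  rfl

end Rotation

/-! ### Point derivations -/

section PointDerivations

variable {A : Type u} [NonUnitalNormedRing A] [NormedSpace ℂ A]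

theorem isZeroPointAmenable_iff : IsZeroPointAmenable A ↔
    ∀ φ : A →L[ℂ] ℂ, (∀ a b, φ (a * b) = φ a * φ b) →
      ∀ D : A →L[ℂ] ℂ, (∀ a b, D (a * b) = D a * φ b + φ a * D b) → D = 0 := by
  constructor
  · intro hA φ hφ D hD
    refine hA (StrongDual.toWeakDual φ) ?_ D hD
    by_cases h : φ = 0
    · exact Or.inr (by simp [h])
    · exact Or.inl ⟨fun h' => h (by simpa using h'), hφ⟩
  · intro h φ hφ D hD
    refine h (WeakDual.toStrongDual φ) ?_ D hD
    rcases hφ with hφ | rfl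
    · exact hφ.2
    · simp

theorem IsZeroPointAmenable.of_surjective {B : Type*} [NonUnitalNormedRing B] [NormedSpace ℂ B]
    (hB : IsZeroPointAmenable B) (θ : B →L[ℂ] A) (hθ : ∀ a b, θ (a * b) = θ a * θ b)
    (hs : Function.Surjective θ) : IsZeroPointAmenable A := by
  rw [isZeroPointAmenable_iff] at *
  intro φ hφ D hD
  have h := hB (φ ∘L θ) (by simp [hθ, hφ]) (D ∘L θ) (by simp [hθ, hD])
  ext a
  obtain ⟨b, rfl⟩ := hs a
  exact congrArg (fun g => g b) h

open ZeroAtInftyContinuousMap in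
theorem IsZeroPointAmenable.zeroAtInfty [IsScalarTower ℂ A A] [SMulCommClass ℂ A A]
    (hA : IsZeroPointAmenable A) (X : Type v) [TopologicalSpace X] [LocallyCompactSpace X]
    [T2Space X] : IsZeroPointAmenable C₀(X, A) := by
  rw [isZeroPointAmenable_iff] at *
  intro φ hφ D hD
  by_cases hφ0 : φ = 0
  · subst hφ0
    refine ext_tensor_mul fun h k a => ?_
    -- A point derivation at `0` is a functional that kills products.
    have : D ∘L tensor (h * k) = 0 := hA 0 (by simp) _ fun a b => by
      rw [comp_apply, ← tensor_mul_tensor, hD]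
      simp
    exact congrArg (fun g => g a) this
  obtain ⟨k, l, a₀, hkl⟩ : ∃ k l a, φ (tensor (k * l) a) ≠ 0 := by
    by_contra! h
    exact hφ0 (ext_tensor_mul h)
  obtain ⟨b₀, hb₀⟩ : ∃ b, φ b ≠ 0 := ⟨_, hkl⟩
  -- The ratio `φ (h b) / φ b` does not depend on `b`, so `φ` induces a character `χ` of `C_b(X)`.
  let χ : (X →ᵇ ℂ) →L[ℂ] ℂ := (φ b₀)⁻¹ • (φ ∘L boundedSMul.flip b₀)
  have hχ : ∀ h b, φ (boundedSMul h b) = χ h * φ b := by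
    intro h b
    have : φ (boundedSMul h b) * φ b₀ = φ b * φ (boundedSMul h b₀) := by
      rw [← hφ, ← hφ, ← boundedSMul_mul_left, boundedSMul_mul_right]
    have hχh : χ h = (φ b₀)⁻¹ * φ (boundedSMul h b₀) := rfl
    rw [hχh]
    field_simp
    linear_combination this
  have χ_one : χ 1 = 1 := by
    have := hχ 1 b₀
    rw [boundedSMul_one] at this
    exact mul_right_cancel₀ hb₀ (by rw [← this, one_mul])
  have χ_mul : ∀ h k, χ (h * k) = χ h * χ k := by
    intro h k
    refine mul_right_cancel₀ hb₀ ?_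
    rw [← hχ, boundedSMul_mul, hχ, hχ, mul_assoc]
  -- The defect of `D` from being `χ`-linear, measured at `b₀`, is a point derivation of `C_b(X)` at
  -- `χ` and hence zero.
  let d : (X →ᵇ ℂ) →L[ℂ] ℂ := D ∘L boundedSMul.flip b₀ - D b₀ • χ
  have hd : ∀ h, d h = D (boundedSMul h b₀) - D b₀ * χ h := fun h => rfl
  have hDd : ∀ h b, φ b₀ * (D (boundedSMul h b) - χ h * D b) = φ b * d h := by
    intro h b
    have h₁ := hD (boundedSMul h b) b₀
    rw [← boundedSMul_mul_left, boundedSMul_mul_right, hD, hχ] at h₁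
    rw [hd]
    rw [hχ] at h₁
    linear_combination -h₁
  have hd0 : d = 0 := by
    refine BoundedContinuousFunction.derivation_eq_zero (mul ℂ ℂ ∘L χ)
      (fun h k w => by simp [χ_mul, mul_assoc]) (fun w => by simp [χ_one]) d fun h k => ?_
    refine mul_left_cancel₀ hb₀ ?_
    have h₁ := hDd h (boundedSMul k b₀)
    rw [← boundedSMul_mul, hχ] at h₁
    simp only [comp_apply, mul_apply']
    rw [hd (h * k), χ_mul, hd k]
    linear_combination h₁
  have hDχ : ∀ h b, D (boundedSMul h b) = χ h * D b := by
    intro h b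
    have := hDd h b
    rw [hd0, _root_.zero_apply, mul_zero, mul_eq_zero] at this
    exact sub_eq_zero.1 (this.resolve_left hb₀)
  have hk : χ k.toBCF ≠ 0 := by
    intro h
    rw [← boundedSMul_toBCF_tensor, hχ, h, zero_mul] at hkl
    exact hkl rfl
  -- As `χ h₀ = 1`, neither `φ` nor `D` distinguishes `h₀` from `h₀ * h₀` in a tensor. So `a ↦ φ (h₀
  -- ⊗ a)` is multiplicative and `a ↦ D (h₀ ⊗ a)` is a point derivation at it.
  let h₀ : C₀(X, ℂ) := (χ k.toBCF)⁻¹ • k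
  have hh₀ : χ h₀.toBCF = 1 := by
    have : h₀.toBCF = (χ k.toBCF)⁻¹ • k.toBCF := rfl
    rw [this, map_smul, smul_eq_mul, inv_mul_cancel₀ hk]
  have hφ₀ : ∀ l a, φ (tensor l a) = φ (tensor (h₀ * l) a) := fun l a => by
    rw [← boundedSMul_toBCF_tensor, hχ, hh₀, one_mul]
  have hD₀ : ∀ l a, D (tensor l a) = D (tensor (h₀ * l) a) := fun l a => by
    rw [← boundedSMul_toBCF_tensor, hDχ, hh₀, one_mul]
  have hzero : D ∘L tensor h₀ = 0 := by
    refine hA (φ ∘L tensor h₀) (fun a b => ?_) _ fun a b => ?_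
    · simp only [comp_apply]
      rw [hφ₀, ← tensor_mul_tensor, hφ]
    · simp only [comp_apply]
      rw [hD₀, ← tensor_mul_tensor, hD]
  refine ext_tensor fun l a => ?_
  have : D (tensor h₀ a) = 0 := congrArg (fun g => g a) hzero
  rw [hD₀, mul_comm, ← boundedSMul_toBCF_tensor, hDχ, this, mul_zero,
    _root_.zero_apply]

end PointDerivations

/-! ### Weak amenability of commutative algebras -/

section WeakAmenability

variable {A : Type u} [NonUnitalNormedRing A] [NormedSpace ℂ A] [IsScalarTower ℂ A A]
  [SMulCommClass ℂ A A]

/-- The two actions of a commutative algebra on its dual agree, so zero is the only inner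
derivation. -/
theorem isWeaklyAmenable_iff_of_commutative (hcomm : ∀ a b : A, a * b = b * a) :
    IsWeaklyAmenable A ↔ ∀ D : A →L[ℂ] StrongDual ℂ A,
      (∀ a b c, D (a * b) c = D a (b * c) + D b (a * c)) → D = 0 := by
  have hder : ∀ D : A →L[ℂ] StrongDual ℂ A, (BanachBimodule.regular A).dual.IsDerivation D ↔
      ∀ a b c, D (a * b) c = D a (b * c) + D b (a * c) := fun D => by
    refine forall₂_congr fun a b => ContinuousLinearMap.ext_iff.trans (forall_congr' fun c => ?_)
    rw [hcomm a c]
    rfl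
  have hinn : ∀ D : A →L[ℂ] StrongDual ℂ A,
      (BanachBimodule.regular A).dual.IsInner D ↔ D = 0 := fun D => by
    have h0 : ∀ z a, (BanachBimodule.regular A).dual.left a z -
        (BanachBimodule.regular A).dual.right a z = 0 := fun z a => by
      ext c
      change z (c * a) - z (a * c) = 0
      rw [hcomm, sub_self]
    constructor
    · rintro ⟨z, hz⟩
      ext1 a
      rw [hz, h0, zero_apply]
    · rintro rfl
      exact ⟨0, fun a => by rw [h0, zero_apply]⟩
  simp only [IsWeaklyAmenable, hder, hinn]

theorem IsWeaklyAmenable.of_surjective {B : Type*} [NonUnitalNormedRing B] [NormedSpace ℂ B]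
    [IsScalarTower ℂ B B] [SMulCommClass ℂ B B] (hcA : ∀ a b : A, a * b = b * a)
    (hcB : ∀ a b : B, a * b = b * a)
    (hB : IsWeaklyAmenable B) (θ : B →L[ℂ] A) (hθ : ∀ a b, θ (a * b) = θ a * θ b)
    (hs : Function.Surjective θ) : IsWeaklyAmenable A := by
  rw [isWeaklyAmenable_iff_of_commutative hcA]
  rw [isWeaklyAmenable_iff_of_commutative hcB] at hB
  intro D hD
  have h := hB ((compL ℂ B A ℂ).flip θ ∘L D ∘L θ) (by simp [hθ, hD])
  ext a c
  obtain ⟨a, rfl⟩ := hs a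
  obtain ⟨c, rfl⟩ := hs c
  exact congrArg (fun g => g a c) h

/-- The products span a dense subspace of a commutative weakly amenable algebra. -/
theorem IsWeaklyAmenable.eq_zero_of_forall_mul (hcomm : ∀ a b : A, a * b = b * a)
    (hA : IsWeaklyAmenable A) {f : StrongDual ℂ A} (hf : ∀ a b, f (a * b) = 0) : f = 0 := by
  rw [isWeaklyAmenable_iff_of_commutative hcomm] at hA
  -- The rank-one map `a ↦ f a • f` is a derivation because `f` kills products.
  have h := hA (f.smulRight f) (by simp [hf])
  ext a
  have : f a * f a = 0 := congrArg (fun g => g a a) h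
  simpa using this

open ZeroAtInftyContinuousMap in
theorem IsWeaklyAmenable.zeroAtInfty (hcomm : ∀ a b : A, a * b = b * a)
    (hA : IsWeaklyAmenable A) (X : Type v) [TopologicalSpace X] [LocallyCompactSpace X]
    [T2Space X] : IsWeaklyAmenable C₀(X, A) := by
  have hcB : ∀ f g : C₀(X, A), f * g = g * f := fun f g => by ext x; exact hcomm _ _
  rw [isWeaklyAmenable_iff_of_commutative hcB]
  intro D hD
  have hdense : ∀ F : StrongDual ℂ C₀(X, A), (∀ a b, F (a * b) = 0) → F = 0 := by
    intro F hF
    refine ext_tensor_mul fun h k a => ?_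
    have : F ∘L tensor (h * k) = 0 := hA.eq_zero_of_forall_mul hcomm fun a b => by
      rw [comp_apply, ← tensor_mul_tensor, hF]
    exact congrArg (fun g => g a) this
  let T : (X →ᵇ ℂ) → C₀(X, A) →L[ℂ] StrongDual ℂ C₀(X, A) := fun h =>
    D ∘L boundedSMul h - (compL ℂ C₀(X, A) C₀(X, A) ℂ).flip (boundedSMul h) ∘L D
  have hT : ∀ h b y, T h b y = D (boundedSMul h b) y - D b (boundedSMul h y) :=
    fun _ _ _ => rfl
  -- The two Leibniz terms containing `D c` cancel, so the commutator `T h` is a module map over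
  -- `C₀(X, A)`; density of products then makes it one over `C_b(X)`.
  have hTmul : ∀ h b c y, T h (b * c) y = T h b (c * y) := by
    intro h b c y
    have e₁ : boundedSMul h b * y = b * boundedSMul h y := by
      rw [← boundedSMul_mul_left, boundedSMul_mul_right]
    have e₂ : c * boundedSMul h y = boundedSMul h (c * y) := (boundedSMul_mul_right h c y).symm
    rw [hT, hT, boundedSMul_mul_left, hD, hD, e₁, e₂]
    ring
  have hTsmul : ∀ h k b y, T h (boundedSMul k b) y = T h b (boundedSMul k y) := by
    intro h k b y
    have : (T h).flip y ∘L boundedSMul k - (T h).flip (boundedSMul k y) = 0 :=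
      hdense _ fun b c => by
        change T h (boundedSMul k (b * c)) y - T h (b * c) (boundedSMul k y) = 0
        rw [boundedSMul_mul_right, hTmul, hTmul, ← boundedSMul_mul_left, boundedSMul_mul_right,
          sub_self]
    exact sub_eq_zero.1 (congrArg (fun g => g b) this)
  have hDsmul : ∀ h b y, D (boundedSMul h b) y = D b (boundedSMul h y) := fun h b y => by
    have := BoundedContinuousFunction.map_smul_of_commutator boundedSMul boundedSMul_mul
      ((compL ℂ C₀(X, A) C₀(X, A) ℂ).flip ∘L boundedSMul)
      (fun h k f => by
        ext y
        exact congrArg f ((boundedSMul_mul h k y).trans (boundedSMul_comm h k y)))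
      (fun f => by ext y; exact congrArg f (boundedSMul_one y)) D
      (fun h k b => by ext y; exact hTsmul h k b y) h b
    exact congrArg (fun g => g y) this
  -- Splitting `(h * l) ⊗ (a * b)` sends `l` or `h` into the second argument of `D`; `hDsmul` brings
  -- it back, so both Leibniz terms again contain `h * l`.
  have hzero : ∀ h l k : C₀(X, ℂ), (compL ℂ A C₀(X, A) ℂ).flip (tensor k) ∘L D ∘L
      tensor (h * l) = 0 := by
    intro h l k
    refine (isWeaklyAmenable_iff_of_commutative hcomm).1 hA _ fun a b c => ?_
    simp only [comp_apply, flip_apply, compL_apply]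
    rw [← tensor_mul_tensor, hD, tensor_mul_tensor, tensor_mul_tensor]
    rw [← boundedSMul_toBCF_tensor l k, ← hDsmul, boundedSMul_toBCF_tensor,
      ← boundedSMul_toBCF_tensor h k, ← hDsmul, boundedSMul_toBCF_tensor, mul_comm l h]
  refine ext_tensor_mul fun h l a => ext_tensor fun k c => ?_
  exact congrArg (fun g => g a c) (hzero h l k)

end WeakAmenability

/-! ### Averaging over commutative groups -/

section InvariantMean

variable {V : Type*} [NormedAddCommGroup V] [NormedSpace ℂ V]

/-- Bounded families of functionals converge weak-* along ultrafilters. -/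
theorem StrongDual.exists_tendsto_apply_of_bounded {ι : Type*} (U : Ultrafilter ι)
    (F : ι → StrongDual ℂ V) {C : ℝ} (hF : ∀ i, ‖F i‖ ≤ C) :
    ∃ M : StrongDual ℂ V, ‖M‖ ≤ C ∧ ∀ x, Tendsto (fun i => F i x) U (𝓝 (M x)) := by
  have hK := WeakDual.isCompact_closedBall (𝕜 := ℂ) (E := V) 0 C
  obtain ⟨M, hM, hle⟩ := hK.ultrafilter_le_nhds
    (U.map fun i => StrongDual.toWeakDual (F i)) (by
      rw [le_principal_iff]
      refine Filter.mem_map.2 (Filter.univ_mem' fun i => ?_)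
      simpa using hF i)
  refine ⟨WeakDual.toStrongDual M, by simpa using hM, fun x => ?_⟩
  exact ((WeakDual.eval_continuous x).tendsto M).comp hle

/-- Almost invariant means on a commutative group. -/
theorem exists_almost_invariant_mean {G : Type*} [CommGroup G] (s : Finset G) {ε : ℝ}
    (hε : 0 < ε) :
    ∃ L : (G → ℂ) →ₗ[ℂ] ℂ, (∀ φ (C : ℝ), (∀ g, ‖φ g‖ ≤ C) → ‖L φ‖ ≤ C) ∧
      (∀ c : ℂ, L (fun _ => c) = c) ∧
      ∀ g ∈ s, ∀ φ (C : ℝ), (∀ g, ‖φ g‖ ≤ C) → ‖L (fun x => φ (g * x)) - L φ‖ ≤ ε * C := by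
  classical
  induction s using Finset.induction_on with
  | empty => exact ⟨LinearMap.proj 1, fun φ C h => h 1, fun c => rfl, by simp⟩
  | insert g₀ s _ ih =>
    obtain ⟨L, hL, hL₁, hLs⟩ := ih
    obtain ⟨N, hN⟩ := exists_nat_gt (2 / ε)
    have hNpos : (0 : ℝ) < N := (by positivity : 0 < 2 / ε).trans hN
    have hN0 : (N : ℂ) ≠ 0 := by exact_mod_cast hNpos.ne'
    let τ : G → (G → ℂ) →ₗ[ℂ] (G → ℂ) := fun g => LinearMap.funLeft ℂ ℂ (g * ·)
    -- Averaging over the first `N` powers of `g₀` telescopes, with defect at most `2 C / N < ε C`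
    -- for `g₀` when `C > 0`. Commutativity preserves the almost invariance already obtained for
    -- `s`.
    let L' : (G → ℂ) →ₗ[ℂ] ℂ := (N : ℂ)⁻¹ • ∑ j ∈ Finset.range N, L ∘ₗ τ (g₀ ^ j)
    have hL' : ∀ φ, L' φ = (N : ℂ)⁻¹ * ∑ j ∈ Finset.range N, L (fun x => φ (g₀ ^ j * x)) := by
      intro φ
      simp only [L', LinearMap.smul_apply, LinearMap.sum_apply, smul_eq_mul]
      rfl
    have hmean : ∀ (f : ℕ → ℂ) (C : ℝ), (∀ j, ‖f j‖ ≤ C) →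
        ‖(N : ℂ)⁻¹ * ∑ j ∈ Finset.range N, f j‖ ≤ C := by
      intro f C hf
      rw [norm_mul, norm_inv, Complex.norm_natCast, inv_mul_le_iff₀ hNpos]
      refine (norm_sum_le_of_le _ fun j _ => hf j).trans ?_
      simp
    refine ⟨L', fun φ C h => ?_, fun c => ?_, fun g hg φ C h => ?_⟩
    · rw [hL']
      exact hmean _ _ fun j => hL _ _ fun g => h _
    · rw [hL']
      simp only [hL₁, Finset.sum_const, Finset.card_range, nsmul_eq_mul]
      rw [inv_mul_cancel_left₀ hN0]
    · rw [hL', hL', ← mul_sub, ← Finset.sum_sub_distrib]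
      rcases Finset.mem_insert.1 hg with rfl | hg
      · have htel : ∑ j ∈ Finset.range N,
            (L (fun x => φ (g * (g ^ j * x))) - L (fun x => φ (g ^ j * x))) =
            L (fun x => φ (g ^ N * x)) - L (fun x => φ (g ^ 0 * x)) := by
          rw [← Finset.sum_range_sub (fun j => L (fun x => φ (g ^ j * x)))]
          simp only [pow_succ', mul_assoc]
        have hb : ‖L (fun x => φ (g ^ N * x)) - L (fun x => φ (g ^ 0 * x))‖ ≤ C + C :=
          norm_sub_le_of_le (hL _ _ fun x => h _) (hL _ _ fun x => h _)
        have hC : 0 ≤ C := (norm_nonneg _).trans (h 1)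
        rw [htel, norm_mul, norm_inv, Complex.norm_natCast, inv_mul_le_iff₀ hNpos]
        rw [div_lt_iff₀ hε] at hN
        nlinarith
      · refine hmean _ _ fun j => ?_
        have := hLs g hg (fun x => φ (g₀ ^ j * x)) C fun x => h _
        simpa only [mul_left_comm] using this

/-- Averaging a bounded family of functionals over a commutative group. -/
theorem StrongDual.exists_average {G : Type*} [CommGroup G] (Φ : G → StrongDual ℂ V) {C : ℝ}
    (hΦ : ∀ g, ‖Φ g‖ ≤ C) :
    ∃ M : StrongDual ℂ V, ‖M‖ ≤ C ∧
      (∀ g x y, (∀ t, Φ t x = Φ (g * t) y) → M x = M y) ∧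
      ∀ x c, (∀ t, Φ t x = c) → M x = c := by
  classical
  -- The index carries a finite set and the tolerance `1 / (n + 1)`; an ultrafilter finer than
  -- `atTop` makes the limit exactly invariant.
  choose L hL hL₁ hLs using fun i : Finset G × ℕ =>
    exists_almost_invariant_mean i.1 (Nat.one_div_pos_of_nat (α := ℝ) (n := i.2))
  have hC : 0 ≤ C := (norm_nonneg _).trans (hΦ 1)
  have hx : ∀ x t, ‖Φ t x‖ ≤ C * ‖x‖ := fun x t => (Φ t).le_of_opNorm_le (hΦ t) x
  let F : Finset G × ℕ → StrongDual ℂ V := fun i =>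
    LinearMap.mkContinuous
      { toFun := fun x => L i (fun t => Φ t x)
        map_add' := fun x y => by
          rw [← map_add]; congr 1; ext t; simp
        map_smul' := fun c x => by
          rw [RingHom.id_apply, ← map_smul]; congr 1; ext t; simp } C
      (fun x => hL i _ _ (hx x))
  have hF : ∀ i x, F i x = L i (fun t => Φ t x) := fun _ _ => rfl
  obtain ⟨M, hM, hlim⟩ := exists_tendsto_apply_of_bounded (Ultrafilter.of atTop) F
    (fun i => LinearMap.mkContinuous_norm_le _ hC _)
  refine ⟨M, hM, fun g x y hxy => ?_, fun x c hc => ?_⟩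
  · have hsub : Tendsto (fun i => F i x - F i y) (Ultrafilter.of (atTop : Filter (Finset G × ℕ)))
        (𝓝 0) := by
      refine Tendsto.mono_left ?_ (Ultrafilter.of_le _)
      have h0 : Tendsto (fun i : Finset G × ℕ => 1 / ((i.2 : ℝ) + 1) * (C * ‖y‖)) atTop
          (𝓝 0) := by
        have : Tendsto (fun i : Finset G × ℕ => i.2) atTop atTop := by
          rw [← prod_atTop_atTop_eq]; exact tendsto_snd
        simpa using (tendsto_one_div_add_atTop_nhds_zero_nat.comp this).mul_const (C * ‖y‖)
      refine squeeze_zero_norm' ?_ h0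
      filter_upwards [eventually_ge_atTop (({g}, 0) : Finset G × ℕ)] with i hi
      have hg : g ∈ i.1 := hi.1 (Finset.mem_singleton_self g)
      simp only [hF, hxy]
      exact hLs i g hg (fun t => Φ t y) _ (hx y)
    have := tendsto_nhds_unique ((hlim x).sub (hlim y)) hsub
    exact sub_eq_zero.1 this
  · refine tendsto_nhds_unique (hlim x) ?_
    simp only [hF, hc, hL₁]
    exact tendsto_const_nhds

end InvariantMean

/-! ### Bilinear forms and rotated virtual diagonals -/

section BilinearForms

variable {E F : Type*} [NormedAddCommGroup E] [NormedSpace ℂ E] [NormedAddCommGroup F]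
  [NormedSpace ℂ F]

/-- The bilinear form `(x, y) ↦ T (p x) (q y)`. -/
noncomputable def bilinearPullback (p q : F →L[ℂ] E) :
    (E →L[ℂ] E →L[ℂ] ℂ) →L[ℂ] F →L[ℂ] F →L[ℂ] ℂ :=
  compL ℂ F (E →L[ℂ] ℂ) (F →L[ℂ] ℂ) ((compL ℂ F E ℂ).flip q) ∘L
    (compL ℂ F E (E →L[ℂ] ℂ)).flip p

@[simp]
theorem bilinearPullback_apply (p q : F →L[ℂ] E) (T : E →L[ℂ] E →L[ℂ] ℂ) (x y : F) :
    bilinearPullback p q T x y = T (p x) (q y) := rfl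

set_option maxSynthPendingDepth 3 in
theorem norm_bilinearPullback_le (p q : F →L[ℂ] E) : ‖bilinearPullback p q‖ ≤ ‖p‖ * ‖q‖ := by
  refine opNorm_le_bound _ (by positivity) fun T => opNorm_le_bound₂ _ (by positivity) fun x y => ?_
  rw [bilinearPullback_apply]
  calc ‖T (p x) (q y)‖ ≤ ‖T‖ * ‖p x‖ * ‖q y‖ := T.le_opNorm₂ _ _
    _ ≤ ‖T‖ * (‖p‖ * ‖x‖) * (‖q‖ * ‖y‖) := by
        gcongr
        · exact p.le_opNorm x
        · exact q.le_opNorm y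
    _ = _ := by ring

end BilinearForms

namespace ZeroAtInftyContinuousMap

variable {X : Type*} [TopologicalSpace X] {E F : Type*} [NormedAddCommGroup E] [NormedSpace ℂ E]
  [NormedAddCommGroup F] [NormedSpace ℂ F]

/-- Composition with a continuous linear map. -/
noncomputable def postcomp (S : E →L[ℂ] F) : C₀(X, E) →L[ℂ] C₀(X, F) :=
  LinearMap.mkContinuous
    { toFun f :=
        { toFun := fun x => S (f x)
          continuous_toFun := S.continuous.comp (map_continuous f)
          zero_at_infty' := by
            simpa [Function.comp_def] using (S.continuous.tendsto 0).comp (zero_at_infty f) }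
      map_add' f g := by ext x; exact S.map_add _ _
      map_smul' c f := by ext x; exact S.map_smul _ _ } ‖S‖
    (fun f => norm_le_of_forall (by positivity) fun x =>
      S.le_opNorm_of_le (norm_apply_le f x))

@[simp]
theorem postcomp_apply (S : E →L[ℂ] F) (f : C₀(X, E)) (x : X) : postcomp S f x = S (f x) := rfl

theorem postcomp_tensor (S : E →L[ℂ] F) (h : C₀(X, ℂ)) (a : E) :
    postcomp S (tensor h a) = tensor h (S a) := by
  ext x; simp

theorem norm_tensor_apply_le (h : C₀(X, ℂ)) : ‖(tensor h : E →L[ℂ] C₀(X, E))‖ ≤ ‖h‖ :=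
  opNorm_le_bound _ (norm_nonneg _) (norm_tensor_le h)

section

variable {A : Type*} [NonUnitalNormedRing A] [NormedSpace ℂ A]

/-- The functional `T ↦ M (T (e u ⊗ ·, e u* ⊗ ·))` on bilinear forms on `C₀(X, A)`. -/
noncomputable def rotated (M : StrongDual ℂ (A →L[ℂ] A →L[ℂ] ℂ)) (e : C₀(X, ℂ)) (u : X →ᵇ ℂ) :
    StrongDual ℂ (C₀(X, A) →L[ℂ] C₀(X, A) →L[ℂ] ℂ) :=
  M ∘L bilinearPullback (tensor (boundedSMul u e)) (tensor (boundedSMul (star u) e))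

set_option maxSynthPendingDepth 3 in
theorem norm_rotated_le (M : StrongDual ℂ (A →L[ℂ] A →L[ℂ] ℂ)) {e : C₀(X, ℂ)} (he : ‖e‖ ≤ 1)
    {u : X →ᵇ ℂ} (hu : u ∈ unitary (X →ᵇ ℂ)) : ‖rotated M e u‖ ≤ ‖M‖ := by
  have key : ∀ v ∈ unitary (X →ᵇ ℂ), ‖(tensor (boundedSMul v e) : A →L[ℂ] C₀(X, A))‖ ≤ 1 := by
    intro v hv
    refine (norm_tensor_apply_le _).trans ((norm_boundedSMul_le v e).trans ?_)
    exact mul_le_one₀ (BoundedContinuousFunction.norm_le_one_of_mem_unitary hv) (norm_nonneg _) he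
  refine (opNorm_comp_le _ _).trans (mul_le_of_le_one_right (norm_nonneg _) ?_)
  exact (norm_bilinearPullback_le _ _).trans
    (mul_le_one₀ (key u hu) (norm_nonneg _) (key _ (Unitary.star_mem hu)))

variable [IsScalarTower ℂ A A] [SMulCommClass ℂ A A]

/-- Moving a unimodular function and an element of `A` across the rotated functionals. -/
theorem rotated_bilinearPullback {M : StrongDual ℂ (A →L[ℂ] A →L[ℂ] ℂ)} (hM : IsVirtualDiagonal M)
    (e : C₀(X, ℂ)) (a : A) (T : C₀(X, A) →L[ℂ] C₀(X, A) →L[ℂ] ℂ) {v : X →ᵇ ℂ}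
    (hv : v ∈ unitary (X →ᵇ ℂ)) (u : X →ᵇ ℂ) :
    rotated M e u (T ∘L boundedSMul v ∘L postcomp (mul ℂ A a)) =
      rotated M e (v * u)
        ((compL ℂ C₀(X, A) C₀(X, A) ℂ).flip (boundedSMul v ∘L postcomp ((mul ℂ A).flip a)) ∘L T) := by
  have h₁ : bilinearPullback (tensor (boundedSMul u e)) (tensor (boundedSMul (star u) e))
      (T ∘L boundedSMul v ∘L postcomp (mul ℂ A a)) = (BanachBimodule.bilinear A).right a
        (bilinearPullback (tensor (boundedSMul (v * u) e)) (tensor (boundedSMul (star u) e)) T) := by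
    ext b c
    simp [postcomp_tensor, boundedSMul_tensor, boundedSMul_mul]
  have h₂ : bilinearPullback (tensor (boundedSMul (v * u) e))
      (tensor (boundedSMul (star (v * u)) e))
      ((compL ℂ C₀(X, A) C₀(X, A) ℂ).flip (boundedSMul v ∘L postcomp ((mul ℂ A).flip a)) ∘L T) =
      (BanachBimodule.bilinear A).left a
        (bilinearPullback (tensor (boundedSMul (v * u) e)) (tensor (boundedSMul (star u) e)) T) := by
    -- Passing from `u` to `v * u` puts `v` on the first factor, and the `v` in the second cancels
    -- its conjugate there. Both sides thus reduce to one form on `A`, across which `M` moves `a`.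
    have : v * star (v * u) = star u := by
      rw [star_mul, mul_left_comm, Unitary.mul_star_self_of_mem hv, mul_one]
    ext b c
    simp only [bilinearPullback_apply, comp_apply, flip_apply, compL_apply, postcomp_tensor,
      boundedSMul_tensor, BanachBimodule.bilinear_left_apply, mul_apply']
    rw [← boundedSMul_mul, this]
  rw [rotated, rotated, comp_apply, comp_apply, h₁, h₂, hM.comm]

/-- Multiplying the two factors cancels `u` against `star u`, so the value is independent of `u` and
survives averaging; only `e * e` remains. -/
theorem rotated_mulAdjoint {M : StrongDual ℂ (A →L[ℂ] A →L[ℂ] ℂ)} (hM : IsVirtualDiagonal M)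
    (e k : C₀(X, ℂ)) (a : A) (f : StrongDual ℂ C₀(X, A)) {u : X →ᵇ ℂ}
    (hu : u ∈ unitary (X →ᵇ ℂ)) :
    rotated M e u (mulAdjoint C₀(X, A) (f ∘L (mul ℂ C₀(X, A)).flip (tensor k a))) =
      f (boundedSMul e.toBCF (boundedSMul e.toBCF (tensor k a))) := by
  have h : bilinearPullback (tensor (boundedSMul u e)) (tensor (boundedSMul (star u) e))
      (mulAdjoint C₀(X, A) (f ∘L (mul ℂ C₀(X, A)).flip (tensor k a))) =
      mulAdjoint A ((f ∘L tensor (e * (e * k))) ∘L (mul ℂ A).flip a) := by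
    have hx : boundedSMul u e * boundedSMul (star u) e = e * e := by
      rw [← boundedSMul_mul_left, ← boundedSMul_mul_right, ← boundedSMul_mul,
        Unitary.mul_star_self_of_mem hu, boundedSMul_one]
    ext b c
    simp only [bilinearPullback_apply, mulAdjoint_apply, comp_apply, flip_apply, mul_apply']
    rw [tensor_mul_tensor, tensor_mul_tensor, hx, mul_assoc e e k]
  rw [rotated, comp_apply, h, hM.product, boundedSMul_toBCF_tensor, boundedSMul_toBCF_tensor,
    comp_apply]

set_option maxSynthPendingDepth 3 in
theorem exists_average_rotated {M : StrongDual ℂ (A →L[ℂ] A →L[ℂ] ℂ)} (hM : IsVirtualDiagonal M)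
    {e : C₀(X, ℂ)} (he : ‖e‖ ≤ 1) :
    ∃ N : StrongDual ℂ (C₀(X, A) →L[ℂ] C₀(X, A) →L[ℂ] ℂ), ‖N‖ ≤ ‖M‖ ∧
      (∀ (a : A) (v : X →ᵇ ℂ) (T : C₀(X, A) →L[ℂ] C₀(X, A) →L[ℂ] ℂ), v ∈ unitary (X →ᵇ ℂ) →
        N (T ∘L boundedSMul v ∘L postcomp (mul ℂ A a)) = N ((compL ℂ C₀(X, A) C₀(X, A) ℂ).flip
          (boundedSMul v ∘L postcomp ((mul ℂ A).flip a)) ∘L T)) ∧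
      ∀ (f : StrongDual ℂ C₀(X, A)) (k : C₀(X, ℂ)) (a : A),
        N (mulAdjoint C₀(X, A) (f ∘L (mul ℂ C₀(X, A)).flip (tensor k a))) =
          f (boundedSMul e.toBCF (boundedSMul e.toBCF (tensor k a))) := by
  obtain ⟨N, hN, hN_inv, hN_const⟩ := StrongDual.exists_average
    (V := C₀(X, A) →L[ℂ] C₀(X, A) →L[ℂ] ℂ)
    (fun u : unitary (X →ᵇ ℂ) => rotated M e (u : X →ᵇ ℂ)) (fun u => norm_rotated_le M he u.2)
  exact ⟨N, hN, fun a v T hv => hN_inv ⟨v, hv⟩ _ _ fun u => rotated_bilinearPullback hM e a T hv u,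
    fun f k a => hN_const _ _ fun u => rotated_mulAdjoint hM e k a f u.2⟩

theorem tendsto_boundedSMul_boundedSMul {ι : Type*} {l : Filter ι} {e : ι → X →ᵇ ℂ}
    (he : ∀ i, ‖e i‖ ≤ 1) {f : C₀(X, E)} (hf : Tendsto (fun i => boundedSMul (e i) f) l (𝓝 f)) :
    Tendsto (fun i => boundedSMul (e i) (boundedSMul (e i) f)) l (𝓝 f) := by
  rw [tendsto_iff_norm_sub_tendsto_zero] at hf ⊢
  refine squeeze_zero (fun _ => norm_nonneg _) (fun i => ?_) (by simpa using hf.add hf)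
  calc _ = ‖boundedSMul (e i) (boundedSMul (e i) f - f) + (boundedSMul (e i) f - f)‖ := by
        rw [map_sub]; congr 1; abel
    _ ≤ _ := by
        refine (norm_add_le _ _).trans (add_le_add ((norm_boundedSMul_le _ _).trans ?_) le_rfl)
        exact mul_le_of_le_one_left (norm_nonneg _) (he i)

-- The averages are bounded by `‖M‖` uniformly in `e`, so a weak-* limit exists, and `e² f → f`
-- along the approximate identity.
variable (X) in
set_option maxSynthPendingDepth 3 in
theorem exists_limit_average_rotated [LocallyCompactSpace X] [T2Space X]
    {M : StrongDual ℂ (A →L[ℂ] A →L[ℂ] ℂ)} (hM : IsVirtualDiagonal M) :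
    ∃ P : StrongDual ℂ (C₀(X, A) →L[ℂ] C₀(X, A) →L[ℂ] ℂ),
      (∀ (a : A) (v : X →ᵇ ℂ) (T : C₀(X, A) →L[ℂ] C₀(X, A) →L[ℂ] ℂ), v ∈ unitary (X →ᵇ ℂ) →
        P (T ∘L boundedSMul v ∘L postcomp (mul ℂ A a)) = P ((compL ℂ C₀(X, A) C₀(X, A) ℂ).flip
          (boundedSMul v ∘L postcomp ((mul ℂ A).flip a)) ∘L T)) ∧
      ∀ (f : StrongDual ℂ C₀(X, A)) (k : C₀(X, ℂ)) (a : A),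
        P (mulAdjoint C₀(X, A) (f ∘L (mul ℂ C₀(X, A)).flip (tensor k a))) = f (tensor k a) := by
  obtain ⟨e, he, hlim⟩ := exists_approximate_identity X
  choose N hN hN_inv hN_prod using fun K => exists_average_rotated hM (he K)
  obtain ⟨P, -, hP⟩ := StrongDual.exists_tendsto_apply_of_bounded
    (V := C₀(X, A) →L[ℂ] C₀(X, A) →L[ℂ] ℂ) (Ultrafilter.of atTop) N hN
  refine ⟨P, fun a v T hv => ?_, fun f k a => ?_⟩
  · exact tendsto_nhds_unique (hP _) ((hP _).congr fun K => (hN_inv K a v T hv).symm)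
  · refine tendsto_nhds_unique (hP _) (Tendsto.congr (fun K => (hN_prod K f k a).symm) ?_)
    exact ((f.continuous.tendsto _).comp
      (tendsto_boundedSMul_boundedSMul he (hlim (tensor k a)))).mono_left (Ultrafilter.of_le _)

-- Unimodular functions span `C_b(X)`, so the invariance holds for every bounded `v`, in particular
-- for `k` in `C₀(X)`. Multiplication by `k ⊗ a` is multiplication by `k` after multiplication by
-- `a`, and elementary tensors are total.
variable (X) in
theorem exists_isVirtualDiagonal [LocallyCompactSpace X] [T2Space X]
    {M : StrongDual ℂ (A →L[ℂ] A →L[ℂ] ℂ)} (hM : IsVirtualDiagonal M) :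
    ∃ N : StrongDual ℂ (C₀(X, A) →L[ℂ] C₀(X, A) →L[ℂ] ℂ), IsVirtualDiagonal N := by
  obtain ⟨P, hunit, hprod⟩ := exists_limit_average_rotated X hM
  refine ⟨P, fun c T => ?_, fun f c => ?_⟩
  · have hall : ∀ (a : A) (v : X →ᵇ ℂ),
        P (T ∘L boundedSMul v ∘L postcomp (mul ℂ A a)) = P ((compL ℂ C₀(X, A) C₀(X, A) ℂ).flip
          (boundedSMul v ∘L postcomp ((mul ℂ A).flip a)) ∘L T) := by
      intro a v
      let S₁ : (X →ᵇ ℂ) →ₗ[ℂ] ℂ :=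
        { toFun := fun v => P (T ∘L boundedSMul v ∘L postcomp (mul ℂ A a))
          map_add' := fun v w => by rw [← map_add]; congr 1; ext; simp
          map_smul' := fun r v => by
            rw [RingHom.id_apply, ← map_smul]; congr 1; ext; simp }
      let S₂ : (X →ᵇ ℂ) →ₗ[ℂ] ℂ :=
        { toFun := fun v => P ((compL ℂ C₀(X, A) C₀(X, A) ℂ).flip
            (boundedSMul v ∘L postcomp ((mul ℂ A).flip a)) ∘L T)
          map_add' := fun v w => by rw [← map_add]; congr 1; ext; simp
          map_smul' := fun r v => by
            rw [RingHom.id_apply, ← map_smul]; congr 1; ext; simp }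
      have : S₁ = S₂ := BoundedContinuousFunction.ext_unitary fun v hv => hunit a v T hv
      exact congrArg (fun g => g v) this
    have : P ∘L (BanachBimodule.bilinear C₀(X, A)).right.flip T =
        P ∘L (BanachBimodule.bilinear C₀(X, A)).left.flip T := ext_tensor fun k a => by
      have h := hall a k.toBCF
      simp only [comp_apply, flip_apply]
      convert h using 2
      · ext f g
        have : tensor k a * f = boundedSMul k.toBCF (postcomp (mul ℂ A a) f) := by
          ext x; simp [smul_mul_assoc]
        simp [this]
      · ext f g
        have : g * tensor k a = boundedSMul k.toBCF (postcomp ((mul ℂ A).flip a) g) := by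
          ext x; simp [mul_smul_comm]
        simp [this]
    exact congrArg (fun g => g c) this
  · have : P ∘L mulAdjoint C₀(X, A) ∘L (compL ℂ C₀(X, A) C₀(X, A) ℂ f) ∘L
        (mul ℂ C₀(X, A)).flip = f := ext_tensor fun k a => by
      exact hprod f k a
    exact congrArg (fun g => g c) this

end

end ZeroAtInftyContinuousMap

theorem theorem5p1 (X : Type v) [TopologicalSpace X] [LocallyCompactSpace X] [T2Space X]
    [Nonempty X] (A : Type u) [NonUnitalNormedRing A] [NormedSpace ℂ A]
    [IsScalarTower ℂ A A] [SMulCommClass ℂ A A] [CompleteSpace A] :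
    (IsAmenable.{max u v, max u v w} C₀(X, A) ↔ IsAmenable.{u, max u v w} A) ∧
    (IsZeroPointAmenable C₀(X, A) ↔ IsZeroPointAmenable A) ∧
    ((∀ a b : A, a * b = b * a) → (IsWeaklyAmenable C₀(X, A) ↔ IsWeaklyAmenable A)) := by
  obtain ⟨x⟩ := ‹Nonempty X›
  have hs : Function.Surjective (ZeroAtInftyContinuousMap.evalCLM x : C₀(X, A) → A) :=
    ZeroAtInftyContinuousMap.evalCLM_surjective x
  refine ⟨⟨fun h => h.of_surjective (ZeroAtInftyContinuousMap.evalCLM x) (fun _ _ => rfl) hs,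
    fun h => ?_⟩,
    ⟨fun h => h.of_surjective (ZeroAtInftyContinuousMap.evalCLM x) (fun _ _ => rfl) hs,
      fun h => h.zeroAtInfty X⟩,
    fun hc => ⟨fun h => h.of_surjective hc (fun f g => by ext y; exact hc _ _)
      (ZeroAtInftyContinuousMap.evalCLM x) (fun _ _ => rfl) hs, fun h => h.zeroAtInfty hc X⟩⟩
  -- The bimodules used to build a virtual diagonal live in the universe of `A`, hence the descent;
  -- a virtual diagonal then gives amenability in any universe.
  obtain ⟨M, hM⟩ := (IsAmenable.descend.{u, max v w} h).exists_isVirtualDiagonal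
  obtain ⟨N, hN⟩ := ZeroAtInftyContinuousMap.exists_isVirtualDiagonal X hM
  exact hN.isAmenable
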